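/- Let $(M,g)$ be a connected smooth Riemannian manifold (finite-dimensional, Hausdorff, without boundary) with Levi-Civita connection $\nabla$, and let $X$ be a smooth vector field on $M$ that is complete, i.e. through every point of $M$ there passes an integral curve of $X$ defined on all of $\mathbb{R}$. For $p\in M$ let $\|\nabla X(p)\|_g$ denote the operator norm of the linear map $T_pM\to T_pM$, $Y\mapsto\nabla_Y X$, with respect to the norm on $T_pM$ induced by $g$, and suppose that $$C:=\sup_{p\in M}\|\nabla X(p)\|_g<\infty .$$ Let $p_0,q_0\in M$ and let $p,q:\mathbb{R}\to M$ be the integral curves of $X$ with $p(0)=p_0$ and $q(0)=q_0$. Then $$d(p(t),q(t))\le d(p_0,q_0)\,e^{Ct}\qquad\text{for all } t\in[0,\infty),$$ where $d$ denotes the Riemannian distance, i.e. the infimum of the lengths of curves joining two points (which is finite, since $M$ is connected). -/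

import Mathlib

open Bundle VectorField
open scoped Manifold ContDiff

set_option linter.unusedSectionVars false

noncomputable section LeviCivita

variable {E : Type*} [NormedAddCommGroup E] [NormedSpace ℝ E] [FiniteDimensional ℝ E]
  {M : Type*} [TopologicalSpace M] [ChartedSpace E M] [IsManifold 𝓘(ℝ, E) ∞ M]
  [RiemannianBundle (fun x : M ↦ TangentSpace 𝓘(ℝ, E) x)]
  [IsContMDiffRiemannianBundle 𝓘(ℝ, E) ∞ E (fun x : M ↦ TangentSpace 𝓘(ℝ, E) x)]

/-- The Koszul expression
`Y g(X,Z) + X g(Y,Z) - Z g(X,Y) + g([Y,X],Z) - g([Y,Z],X) - g([X,Z],Y)` at the point `x`;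
it equals `2 g(∇_Y X, Z)` for the Levi-Civita connection `∇`. -/
def koszul (X Y Z : Π x : M, TangentSpace 𝓘(ℝ, E) x) (x : M) : ℝ :=
  mvfderiv 𝓘(ℝ, E) (fun y ↦ inner ℝ (X y) (Z y)) x (Y x)
    + mvfderiv 𝓘(ℝ, E) (fun y ↦ inner ℝ (Y y) (Z y)) x (X x)
    - mvfderiv 𝓘(ℝ, E) (fun y ↦ inner ℝ (X y) (Y y)) x (Z x)
    + inner ℝ (mlieBracket 𝓘(ℝ, E) Y X x) (Z x)
    - inner ℝ (mlieBracket 𝓘(ℝ, E) Y Z x) (X x)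
    - inner ℝ (mlieBracket 𝓘(ℝ, E) X Z x) (Y x)

section aux

variable {X Y Z Y' : Π x : M, TangentSpace 𝓘(ℝ, E) x} {x : M} {f : M → ℝ}

lemma mdiff_inner (hX : MDiffAt (T% X) x) (hY : MDiffAt (T% Y) x) :
    MDiffAt (fun y ↦ inner ℝ (X y) (Y y)) x := by
  have : IsContMDiffRiemannianBundle 𝓘(ℝ, E) 1 E (fun x : M ↦ TangentSpace 𝓘(ℝ, E) x) :=
    .of_le (n := ∞) (by simp)
  exact MDifferentiableAt.inner_bundle (E := fun x : M ↦ TangentSpace 𝓘(ℝ, E) x) hX hY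

lemma d_inner_comm (X Y : Π x : M, TangentSpace 𝓘(ℝ, E) x) (x : M) :
    mvfderiv 𝓘(ℝ, E) (fun y ↦ inner ℝ (X y) (Y y)) x
      = mvfderiv 𝓘(ℝ, E) (fun y ↦ inner ℝ (Y y) (X y)) x :=
  congrArg (fun u ↦ mvfderiv 𝓘(ℝ, E) u x) (by ext y; exact real_inner_comm _ _)

lemma d_inner_smul (hf : MDiffAt f x) (hX : MDiffAt (T% X) x) (hY : MDiffAt (T% Y) x) :
    mvfderiv 𝓘(ℝ, E) (fun y ↦ inner ℝ ((f • X) y) (Y y)) x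
      = f x • mvfderiv 𝓘(ℝ, E) (fun y ↦ inner ℝ (X y) (Y y)) x
        + inner ℝ (X x) (Y x) • mvfderiv 𝓘(ℝ, E) f x :=
  (congrArg (fun u ↦ mvfderiv 𝓘(ℝ, E) u x) (by ext y; simp [inner_smul_left])).trans
    (mvfderiv_mul hf (mdiff_inner hX hY))

lemma d_inner_add (hX : MDiffAt (T% X) x) (hY : MDiffAt (T% Y) x) (hY' : MDiffAt (T% Y') x) :
    mvfderiv 𝓘(ℝ, E) (fun y ↦ inner ℝ ((Y + Y') y) (X y)) x
      = mvfderiv 𝓘(ℝ, E) (fun y ↦ inner ℝ (Y y) (X y)) x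
        + mvfderiv 𝓘(ℝ, E) (fun y ↦ inner ℝ (Y' y) (X y)) x :=
  (congrArg (fun u ↦ mvfderiv 𝓘(ℝ, E) u x) (by ext y; simp [inner_add_left])).trans
    (mvfderiv_add (mdiff_inner hY hX) (mdiff_inner hY' hX))

lemma koszul_tensorial_left (hX : MDiffAt (T% X) x) (hZ : MDiffAt (T% Z) x) :
    TensorialAt 𝓘(ℝ, E) E (fun Y ↦ koszul X Y Z x) x where
  smul {f Y} hf hY := by
    simp only [koszul]
    rw [d_inner_comm X (f • Y), d_inner_comm X Y, d_inner_smul hf hY hZ, d_inner_smul hf hY hX,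
      mlieBracket_smul_left hf hY, mlieBracket_smul_left hf hY]
    simp [inner_add_left, inner_smul_left, inner_smul_right, real_inner_comm]
    ring
  add {Y Y'} hY hY' := by
    simp only [koszul]
    rw [d_inner_comm X (Y + Y'), d_inner_comm X Y, d_inner_comm X Y', d_inner_add hZ hY hY',
      d_inner_add hX hY hY', mlieBracket_add_left hY hY', mlieBracket_add_left hY hY']
    simp [inner_add_left, inner_add_right]
    ring

lemma koszul_tensorial_right (hX : MDiffAt (T% X) x) (hY : MDiffAt (T% Y) x) :
    TensorialAt 𝓘(ℝ, E) E (fun Z ↦ koszul X Y Z x) x where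
  smul {f Z} hf hZ := by
    simp only [koszul]
    rw [d_inner_comm X (f • Z), d_inner_comm X Z, d_inner_comm Y (f • Z), d_inner_comm Y Z,
      d_inner_smul hf hZ hX, d_inner_smul hf hZ hY,
      mlieBracket_smul_right hf hZ, mlieBracket_smul_right hf hZ]
    simp [inner_add_left, inner_smul_left, inner_smul_right, real_inner_comm]
    ring
  add {Z Z'} hZ hZ' := by
    simp only [koszul]
    rw [d_inner_comm X (Z + Z'), d_inner_comm X Z, d_inner_comm X Z', d_inner_comm Y (Z + Z'),
      d_inner_comm Y Z, d_inner_comm Y Z', d_inner_add hX hZ hZ',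
      d_inner_add hY hZ hZ', mlieBracket_add_right hZ hZ', mlieBracket_add_right hZ hZ']
    simp [inner_add_left, inner_add_right]
    ring

lemma koszul_smul (hf : MDiffAt f x) (hX : MDiffAt (T% X) x) (hY : MDiffAt (T% Y) x)
    (hZ : MDiffAt (T% Z) x) :
    koszul (f • X) Y Z x
      = f x * koszul X Y Z x + 2 * mvfderiv 𝓘(ℝ, E) f x (Y x) * inner ℝ (X x) (Z x) := by
  simp only [koszul]
  rw [d_inner_smul hf hX hZ, d_inner_smul hf hX hY,
    mlieBracket_smul_right hf hX, mlieBracket_smul_left hf hX]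
  simp [inner_add_left, inner_smul_left, inner_smul_right, real_inner_comm]
  ring

lemma koszul_add (hX : MDiffAt (T% X) x) (hY : MDiffAt (T% Y) x) (hY' : MDiffAt (T% Y') x)
    (hZ : MDiffAt (T% Z) x) :
    koszul (Y + Y') X Z x = koszul Y X Z x + koszul Y' X Z x := by
  simp only [koszul]
  rw [d_inner_add hZ hY hY', d_inner_add hX hY hY', mlieBracket_add_right hY hY',
    mlieBracket_add_left hY hY']
  simp [inner_add_left, inner_add_right]
  ring

end aux

instance (x : M) : FiniteDimensional ℝ (TangentSpace 𝓘(ℝ, E) x) :=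
  inferInstanceAs (FiniteDimensional ℝ E)

/-- The bilinear form `(v, w) ↦ 2 g(∇_v X, w)` on the tangent space at `x`, for a vector field `X`
that is differentiable at `x`. -/
def koszulForm (X : Π x : M, TangentSpace 𝓘(ℝ, E) x) (x : M) (hX : MDiffAt (T% X) x) :
    TangentSpace 𝓘(ℝ, E) x →L[ℝ] TangentSpace 𝓘(ℝ, E) x →L[ℝ] ℝ :=
  TensorialAt.mkHom₂ (fun Y Z ↦ koszul X Y Z x) x
    (fun _ hZ ↦ koszul_tensorial_left hX hZ) (fun _ hY ↦ koszul_tensorial_right hX hY)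

lemma koszulForm_apply {X Y Z : Π x : M, TangentSpace 𝓘(ℝ, E) x} {x : M}
    (hX : MDiffAt (T% X) x) (hY : MDiffAt (T% Y) x) (hZ : MDiffAt (T% Z) x) :
    koszulForm X x hX (Y x) (Z x) = koszul X Y Z x :=
  TensorialAt.mkHom₂_apply _ _ hY hZ

open Classical in
/-- The covariant differential `v ↦ ∇_v X` at `x` of the Levi-Civita connection: for `X`
differentiable at `x` it is the linear map with `2 g(∇_v X, w) = koszulForm X x v w`. Vector fields
that are not differentiable at `x` get the junk value `0`. -/
def nablaAt (X : Π x : M, TangentSpace 𝓘(ℝ, E) x) (x : M) :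
    TangentSpace 𝓘(ℝ, E) x →L[ℝ] TangentSpace 𝓘(ℝ, E) x :=
  if hX : MDiffAt (T% X) x then
    LinearMap.toContinuousLinearMap
      { toFun v := (1 / 2 : ℝ) •
          (InnerProductSpace.toDual ℝ (TangentSpace 𝓘(ℝ, E) x)).symm (koszulForm X x hX v)
        map_add' v w := by rw [map_add, map_add, smul_add]
        map_smul' c v := by
          rw [map_smul, map_smulₛₗ, smul_comm]
          rfl }
  else 0

/-- The Koszul formula. -/
lemma inner_nablaAt {X Y Z : Π x : M, TangentSpace 𝓘(ℝ, E) x} {x : M}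
    (hX : MDiffAt (T% X) x) (hY : MDiffAt (T% Y) x) (hZ : MDiffAt (T% Z) x) :
    2 * inner ℝ (nablaAt X x (Y x)) (Z x) = koszul X Y Z x := by
  rw [← koszulForm_apply hX hY hZ]
  simp only [nablaAt, hX, dif_pos, LinearMap.coe_toContinuousLinearMap', LinearMap.coe_mk,
    AddHom.coe_mk]
  rw [real_inner_smul_left, InnerProductSpace.toDual_symm_apply]
  ring

lemma clm_ext_of_inner {x : M} {A B : TangentSpace 𝓘(ℝ, E) x →L[ℝ] TangentSpace 𝓘(ℝ, E) x}
    (h : ∀ Y Z : Π x : M, TangentSpace 𝓘(ℝ, E) x, MDiffAt (T% Y) x → MDiffAt (T% Z) x →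
      inner ℝ (A (Y x)) (Z x) = inner ℝ (B (Y x)) (Z x)) : A = B := by
  ext v
  refine ext_inner_right ℝ fun w ↦ ?_
  have := h (FiberBundle.extend E v) (FiberBundle.extend E w)
    (FiberBundle.mdifferentiableAt_extend ..) (FiberBundle.mdifferentiableAt_extend ..)
  simpa using this

variable (E M) in
/-- The Levi-Civita connection of the Riemannian manifold `M`. -/
def leviCivita : CovariantDerivative 𝓘(ℝ, E) E (TangentSpace 𝓘(ℝ, E) : M → Type _) where
  toFun := nablaAt
  isCovariantDerivativeOnUniv :=
    { add := by
        intro σ σ' x hσ hσ' _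
        refine clm_ext_of_inner fun Y Z hY hZ ↦ ?_
        have h := inner_nablaAt (mdifferentiableAt_add_section hσ hσ') hY hZ
        rw [koszul_add hY hσ hσ' hZ, ← inner_nablaAt hσ hY hZ, ← inner_nablaAt hσ' hY hZ] at h
        rw [add_apply, inner_add_left]
        linarith
      leibniz := by
        intro σ g x hσ hg _
        refine clm_ext_of_inner fun Y Z hY hZ ↦ ?_
        have h := inner_nablaAt (hg.smul_section hσ) hY hZ
        rw [koszul_smul hg hσ hY hZ, ← inner_nablaAt hσ hY hZ] at h
        rw [add_apply, inner_add_left, smul_apply,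
          ContinuousLinearMap.smulRight_apply, real_inner_smul_left, real_inner_smul_left]
        linarith }

/-- The Levi-Civita connection is torsion free. -/
lemma leviCivita_torsion : (leviCivita E M).torsion = 0 := by
  rw [CovariantDerivative.torsion_eq_zero_iff]
  intro X Y x hX hY
  refine ext_inner_right ℝ fun w ↦ ?_
  have hZ : MDiffAt (T% (FiberBundle.extend E w : Π x : M, TangentSpace 𝓘(ℝ, E) x)) x :=
    FiberBundle.mdifferentiableAt_extend ..
  have h1 := inner_nablaAt hX hY hZ
  have h2 := inner_nablaAt hY hX hZ
  simp only [koszul] at h1 h2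
  rw [d_inner_comm Y X, mlieBracket_swap_apply (V := Y) (W := X)] at *
  simp only [FiberBundle.extend_apply_self, inner_neg_left] at h1 h2
  rw [inner_sub_left]
  change inner ℝ (nablaAt Y x (X x)) w - inner ℝ (nablaAt X x (Y x)) w = _
  linarith

/-- The Levi-Civita connection is compatible with the metric. -/
lemma leviCivita_metric {X Y Z : Π x : M, TangentSpace 𝓘(ℝ, E) x} {x : M}
    (hX : MDiffAt (T% X) x) (hY : MDiffAt (T% Y) x) (hZ : MDiffAt (T% Z) x) :
    mvfderiv 𝓘(ℝ, E) (fun y ↦ inner ℝ (X y) (Y y)) x (Z x)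
      = inner ℝ (leviCivita E M X x (Z x)) (Y x) + inner ℝ (X x) (leviCivita E M Y x (Z x)) := by
  have h1 := inner_nablaAt hX hZ hY
  have h2 := inner_nablaAt hY hZ hX
  simp only [koszul] at h1 h2
  rw [d_inner_comm Y X, d_inner_comm Y Z, d_inner_comm Z X,
    mlieBracket_swap_apply (V := Y) (W := X), inner_neg_left] at h2
  change _ = inner ℝ (nablaAt X x (Z x)) (Y x) + inner ℝ (X x) (nablaAt Y x (Z x))
  rw [real_inner_comm (nablaAt Y x (Z x)) (X x)]
  linarith

end LeviCivita

/-- A vector field is complete if through every point there passes an integral curve that is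
defined on all of `ℝ`. -/
def IsCompleteVectorField {E : Type*} [NormedAddCommGroup E] [NormedSpace ℝ E]
    {M : Type*} [TopologicalSpace M] [ChartedSpace E M]
    (X : Π x : M, TangentSpace 𝓘(ℝ, E) x) : Prop :=
  ∀ x : M, ∃ γ : ℝ → M, γ 0 = x ∧ IsMIntegralCurve γ X

/-! Let `φ` be the flow of `X`. A vector `v` carried along by it satisfies `d/dt |v|² = (L_X g)(v,
v) = 2 g(∇_v X, v) ≤ 2 C |v|²`, so by Grönwall the time `t` map stretches tangent vectors, hence
lengths of curves and distances, by at most `exp (C t)`.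

The argument is run without differentiating the flow in its initial point. In a chart, the
difference of two nearby integral curves `a`, `b` plays the role of `v`, and its squared length is
measured by the metric at `a`. Near a given point this quantity grows at rate at most `2 (C + ε)`
(`exists_nhds_growth`, `sq_length_le_exp_mul`), where the infinitesimal bound comes from the Koszul
formula in the chart (`two_mul_inner_leviCivita`).

The outcome is a pointwise stretch bound `HasStretchAt`, stated with the gauge `chartGauge`, a
first-order upper bound for the distance whose rate along a curve is the speed. Stretch bounds
multiply under composition, so short-time bounds chain along an orbit (`hasStretchAt_flow_add`), and
`ε` tends to `0`. Integration along almost minimizing curves turns the pointwise bound into a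
Lipschitz bound (`riemannianEDist_le_of_hasStretchAt`). -/

set_option maxSynthPendingDepth 3

/-! ### Growth of differences of solutions in a normed space -/

section FrozenEstimate

open Filter Topology Set

variable {E : Type*} [NormedAddCommGroup E] [NormedSpace ℝ E]

/-- An infinitesimal growth bound for a vector field `F` and a metric `g` at a point `z₀`, namely
`(L_F g)(v, v) ≤ 2 C g(v, v)`, gives a growth bound for differences of nearby points. -/
lemma exists_nhds_growth {F : E → E} {F' : E →L[ℝ] E} {g : E → E →L[ℝ] E →L[ℝ] ℝ} {z₀ : E}
    (hF : HasStrictFDerivAt F F' z₀) (hg : ContDiffAt ℝ 1 g z₀) {c C ε : ℝ} (hc : 0 < c)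
    (hpos : ∀ v, c * ‖v‖ ^ 2 ≤ g z₀ v v)
    (hC : ∀ v, fderiv ℝ g z₀ (F z₀) v v + g z₀ (F' v) v + g z₀ v (F' v) ≤ 2 * C * g z₀ v v)
    (hε : 0 < ε) :
    ∃ U ∈ 𝓝 z₀, ∀ z ∈ U, DifferentiableAt ℝ g z ∧ (∀ v, c / 2 * ‖v‖ ^ 2 ≤ g z v v) ∧
      ∀ y ∈ U, fderiv ℝ g z (F z) (y - z) (y - z) + g z (F y - F z) (y - z)
        + g z (y - z) (F y - F z) ≤ 2 * (C + ε) * g z (y - z) (y - z) := by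
  have hgc : ContinuousAt g z₀ := hg.continuousAt
  have hdg : ContinuousAt (fderiv ℝ g) z₀ := (hg.fderiv_right (m := 0) le_rfl).continuousAt
  have hdiff : ∀ᶠ z in 𝓝 z₀, DifferentiableAt ℝ g z :=
    (hg.eventually (by simp)).mono fun z hz ↦ hz.differentiableAt one_ne_zero
  -- `B z₀ v v ≤ -2 ε c ‖v‖²` by `hC` and `hpos`. Moving from `z₀` to `z` costs at most `ε c ‖v‖²`,
  -- and replacing `F' v` by `F y - F z` costs at most `ε c / 2 * ‖v‖²` in each of two terms, which
  -- uses up the margin exactly.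
  let B : E → E →L[ℝ] E →L[ℝ] ℝ := fun z ↦ fderiv ℝ g z (F z) + (g z).comp F'
    + (ContinuousLinearMap.compL ℝ E E ℝ).flip F' ∘L g z - (2 * (C + ε)) • g z
  have hB : ContinuousAt B z₀ := by
    have := hF.continuousAt
    fun_prop
  have hBapp : ∀ z v, B z v v = fderiv ℝ g z (F z) v v + g z (F' v) v + g z v (F' v)
      - 2 * (C + ε) * g z v v := fun z v ↦ by simp [B]
  have hle : ∀ (A A' : E →L[ℝ] E →L[ℝ] ℝ) (v : E), A v v ≤ A' v v + ‖A - A'‖ * ‖v‖ ^ 2 := by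
    intro A A' v
    have := (le_abs_self _).trans ((A - A').le_opNorm₂ v v)
    simp only [sub_apply] at this
    nlinarith
  set G := ‖g z₀‖ + 1
  have hG : 0 < G := by positivity
  have h1 : ∀ᶠ z in 𝓝 z₀, ‖B z - B z₀‖ ≤ ε * c := by
    have := (hB.sub (continuousAt_const (y := B z₀))).norm
    have h0 : ‖B z₀ - B z₀‖ < ε * c := by simp; positivity
    exact (this.eventually_lt_const h0).mono fun z hz ↦ hz.le
  have h2 : ∀ᶠ z in 𝓝 z₀, ‖g z₀ - g z‖ ≤ c / 2 := by
    have := ((continuousAt_const (y := g z₀)).sub hgc).norm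
    have h0 : ‖g z₀ - g z₀‖ < c / 2 := by simp; positivity
    exact (this.eventually_lt_const h0).mono fun z hz ↦ hz.le
  have h3 : ∀ᶠ z in 𝓝 z₀, ‖g z‖ ≤ G :=
    (hgc.norm.eventually_lt_const (lt_add_one ‖g z₀‖)).mono fun z hz ↦ hz.le
  -- Strict differentiability is what allows both points to vary; dividing by `G` compensates for
  -- `‖g z‖ ≤ G`.
  have h4 : ∀ᶠ p : E × E in 𝓝 (z₀, z₀), ‖F p.1 - F p.2 - F' (p.1 - p.2)‖
      ≤ ε * c / (2 * G) * ‖p.1 - p.2‖ := hF.isLittleO.def (by positivity)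
  rw [nhds_prod_eq, (basis_sets _).prod_self.eventually_iff] at h4
  obtain ⟨V, hV, hV'⟩ := h4
  refine ⟨_, inter_mem hV (hdiff.and (h1.and (h2.and h3))), ?_⟩
  rintro z ⟨hzV, hz0, hz1, hz2, hz3⟩
  refine ⟨hz0, fun v ↦ ?_, ?_⟩
  · nlinarith [hle (g z₀) (g z) v, hpos v, sq_nonneg ‖v‖]
  rintro y ⟨hyV, -⟩
  have hr : ‖F y - F z - F' (y - z)‖ ≤ ε * c / (2 * G) * ‖y - z‖ := hV' (mk_mem_prod hyV hzV)
  generalize y - z = v at hr ⊢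
  have e : F y - F z = F' v + (F y - F z - F' v) := by abel
  generalize F y - F z - F' v = r at hr e
  have hn : ∀ u w : E, ‖u‖ * ‖w‖ ≤ ε * c / (2 * G) * ‖v‖ ^ 2 → g z u w ≤ ε * c / 2 * ‖v‖ ^ 2 := by
    intro u w huw
    refine ((le_abs_self _).trans ((g z).le_opNorm₂ u w)).trans ?_
    rw [mul_assoc]
    refine (mul_le_mul hz3 huw (by positivity) hG.le).trans (le_of_eq ?_)
    field_simp
  have r1 : g z r v ≤ ε * c / 2 * ‖v‖ ^ 2 := hn r v (by nlinarith [norm_nonneg v])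
  have r2 : g z v r ≤ ε * c / 2 * ‖v‖ ^ 2 := hn v r (by nlinarith [norm_nonneg v])
  have b1 := hle (B z) (B z₀) v
  rw [hBapp, hBapp] at b1
  rw [e]
  simp only [map_add, add_apply]
  nlinarith [hC v, mul_le_mul_of_nonneg_right hz1 (sq_nonneg ‖v‖),
    mul_le_mul_of_nonneg_left (hpos v) hε.le]

/-- Grönwall's inequality for the squared `g`-length of the difference of two integral curves. -/
lemma sq_length_le_exp_mul {F : E → E} {g : E → E →L[ℝ] E →L[ℝ] ℝ} {U : Set E} {κ T : ℝ}
    (hg : ∀ z ∈ U, DifferentiableAt ℝ g z)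
    (hκ : ∀ z ∈ U, ∀ y ∈ U, fderiv ℝ g z (F z) (y - z) (y - z) + g z (F y - F z) (y - z)
      + g z (y - z) (F y - F z) ≤ 2 * κ * g z (y - z) (y - z))
    {a b : ℝ → E} (ha : ∀ t ∈ Icc 0 T, a t ∈ U ∧ HasDerivAt a (F (a t)) t)
    (hb : ∀ t ∈ Icc 0 T, b t ∈ U ∧ HasDerivAt b (F (b t)) t) {t : ℝ} (ht : t ∈ Icc 0 T) :
    g (a t) (b t - a t) (b t - a t)
      ≤ Real.exp (2 * κ * t) * g (a 0) (b 0 - a 0) (b 0 - a 0) := by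
  let h : ℝ → ℝ := fun s ↦ Real.exp (-(2 * κ * s)) * g (a s) (b s - a s) (b s - a s)
  have hd : ∀ s ∈ Icc 0 T, HasDerivAt h (Real.exp (-(2 * κ * s)) * -(2 * κ)
      * g (a s) (b s - a s) (b s - a s) + Real.exp (-(2 * κ * s)) *
      (fderiv ℝ g (a s) (F (a s)) (b s - a s) (b s - a s)
        + g (a s) (F (b s) - F (a s)) (b s - a s)
        + g (a s) (b s - a s) (F (b s) - F (a s)))) s := by
    intro s hs
    obtain ⟨has, has'⟩ := ha s hs
    obtain ⟨hbs, hbs'⟩ := hb s hs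
    have e1 : HasDerivAt (fun s ↦ Real.exp (-(2 * κ * s)))
        (Real.exp (-(2 * κ * s)) * -(2 * κ)) s := by
      simpa using (((hasDerivAt_id s).const_mul (2 * κ)).neg).exp
    have e2 := hbs'.sub has'
    have e3 := (hg _ has).hasFDerivAt.comp_hasDerivAt s has'
    have e4 := (e3.clm_apply e2).clm_apply e2
    exact e1.mul e4
  have hanti : AntitoneOn h (Icc 0 T) := by
    refine antitoneOn_of_deriv_nonpos (convex_Icc 0 T)
      (fun s hs ↦ (hd s hs).continuousAt.continuousWithinAt)
      (fun s hs ↦ (hd s (interior_subset hs)).differentiableAt.differentiableWithinAt) ?_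
    intro s hs
    have hs := interior_subset hs
    rw [(hd s hs).deriv]
    nlinarith [mul_le_mul_of_nonneg_left (hκ _ (ha s hs).1 _ (hb s hs).1)
      (Real.exp_pos (-(2 * κ * s))).le]
  have key := hanti ⟨le_rfl, ht.1.trans ht.2⟩ ht ht.1
  have := mul_le_mul_of_nonneg_left key (Real.exp_pos (2 * κ * t)).le
  simpa only [h, ← mul_assoc, ← Real.exp_add, add_neg_cancel, Real.exp_zero, one_mul, mul_zero,
    neg_zero, mul_one] using this

end FrozenEstimate

/-! ### The vector field, the metric and the connection in a chart -/

section ChartExpressions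

open Filter Topology Set

variable {E : Type*} [NormedAddCommGroup E] [NormedSpace ℝ E] [FiniteDimensional ℝ E]
  {M : Type*} [TopologicalSpace M] [ChartedSpace E M] [IsManifold 𝓘(ℝ, E) ∞ M]

/-- The expression of a vector field in the preferred chart at `x₀`. -/
noncomputable def chartField (X : Π x : M, TangentSpace 𝓘(ℝ, E) x) (x₀ : M) (z : E) : E :=
  (trivializationAt E (TangentSpace 𝓘(ℝ, E)) x₀
    ⟨(extChartAt 𝓘(ℝ, E) x₀).symm z, X ((extChartAt 𝓘(ℝ, E) x₀).symm z)⟩).2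

/-- The identification of the model space with the tangent space at `y` that is induced by the
preferred chart at `x₀`. -/
noncomputable def ofChart (x₀ y : M) : E →L[ℝ] TangentSpace 𝓘(ℝ, E) y :=
  (trivializationAt E (TangentSpace 𝓘(ℝ, E)) x₀).symmL ℝ y

lemma isOpen_extChartAt_target_self (x₀ : M) : IsOpen (extChartAt 𝓘(ℝ, E) x₀).target :=
  isOpen_extChartAt_target x₀

lemma contDiffOn_chartField {X : Π x : M, TangentSpace 𝓘(ℝ, E) x}
    (hX : ContMDiff 𝓘(ℝ, E) 𝓘(ℝ, E).tangent ∞ (fun x ↦ (⟨x, X x⟩ : TangentBundle 𝓘(ℝ, E) M)))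
    (x₀ : M) : ContDiffOn ℝ 1 (chartField X x₀) (extChartAt 𝓘(ℝ, E) x₀).target := by
  have h1 : ContMDiffOn 𝓘(ℝ, E) 𝓘(ℝ, E) ∞
      (fun y ↦ (trivializationAt E (TangentSpace 𝓘(ℝ, E)) x₀ ⟨y, X y⟩).2)
      (trivializationAt E (TangentSpace 𝓘(ℝ, E) : M → Type _) x₀).baseSet :=
    (Trivialization.contMDiffOn_section_baseSet_iff _).1 hX.contMDiffOn
  have h2 := h1.comp (contMDiffOn_extChartAt_symm (n := ∞) (I := 𝓘(ℝ, E)) x₀) (fun z hz ↦ by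
    simpa using (extChartAt 𝓘(ℝ, E) x₀).map_target hz)
  exact (contMDiffOn_iff_contDiffOn.1 h2).of_le (by simp)

lemma ofChart_apply {x₀ y : M} (hy : y ∈ (chartAt E x₀).source) (v : E) :
    ofChart x₀ y v = (trivializationAt E (TangentSpace 𝓘(ℝ, E)) x₀).symm y v :=
  Trivialization.symmL_apply _ hy v

lemma trivializationAt_ofChart {x₀ y : M} (hy : y ∈ (chartAt E x₀).source) (v : E) :
    (trivializationAt E (TangentSpace 𝓘(ℝ, E)) x₀ ⟨y, ofChart x₀ y v⟩).2 = v := by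
  rw [ofChart_apply hy]
  exact congrArg Prod.snd (Trivialization.apply_mk_symm _ hy v)

lemma ofChart_trivializationAt {x₀ y : M} (hy : y ∈ (chartAt E x₀).source)
    (u : TangentSpace 𝓘(ℝ, E) y) :
    ofChart x₀ y (trivializationAt E (TangentSpace 𝓘(ℝ, E)) x₀ ⟨y, u⟩).2 = u := by
  rw [ofChart_apply hy]
  exact Trivialization.symm_apply_apply_mk (trivializationAt E (TangentSpace 𝓘(ℝ, E)) x₀) hy u

lemma ofChart_self (x₀ : M) (v : E) : ofChart x₀ x₀ v = v := by
  rw [ofChart, TangentBundle.symmL_trivializationAt_eq_core (mem_chart_source _ x₀)]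
  exact tangentCoordChange_self (I := 𝓘(ℝ, E)) (mem_extChartAt_source x₀)

variable
  [RiemannianBundle (fun x : M ↦ TangentSpace 𝓘(ℝ, E) x)]
  [IsContMDiffRiemannianBundle 𝓘(ℝ, E) ∞ E (fun x : M ↦ TangentSpace 𝓘(ℝ, E) x)]

/-- The expression of the Riemannian metric in the preferred chart at `x₀`. -/
noncomputable def chartMetric (x₀ : M) (z : E) : E →L[ℝ] E →L[ℝ] ℝ :=
  (innerSL ℝ (E := TangentSpace 𝓘(ℝ, E) ((extChartAt 𝓘(ℝ, E) x₀).symm z))).bilinearComp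
    (ofChart x₀ _) (ofChart x₀ _)

lemma chartMetric_apply (x₀ : M) (z v w : E) :
    chartMetric x₀ z v w = inner ℝ (ofChart x₀ ((extChartAt 𝓘(ℝ, E) x₀).symm z) v)
      (ofChart x₀ ((extChartAt 𝓘(ℝ, E) x₀).symm z) w) := rfl

lemma contMDiffOn_ofChart (x₀ : M) (v : E) :
    ContMDiffOn 𝓘(ℝ, E) 𝓘(ℝ, E).tangent ∞
      (fun y ↦ (⟨y, ofChart x₀ y v⟩ : TangentBundle 𝓘(ℝ, E) M)) (chartAt E x₀).source := by
  rw [← TangentBundle.trivializationAt_baseSet (I := 𝓘(ℝ, E))]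
  rw [Trivialization.contMDiffOn_section_baseSet_iff]
  exact (contMDiffOn_const (c := v)).congr fun y hy ↦
    trivializationAt_ofChart hy v

lemma contDiffOn_chartMetric (x₀ : M) :
    ContDiffOn ℝ 1 (chartMetric x₀) (extChartAt 𝓘(ℝ, E) x₀).target := by
  rw [contDiffOn_clm_apply]
  intro v
  rw [contDiffOn_clm_apply]
  intro w
  have h1 := ContMDiffOn.inner_bundle (E := fun x : M ↦ TangentSpace 𝓘(ℝ, E) x)
    (contMDiffOn_ofChart x₀ v) (contMDiffOn_ofChart x₀ w)
  have h2 := h1.comp (contMDiffOn_extChartAt_symm (n := ∞) (I := 𝓘(ℝ, E)) x₀) (fun z hz ↦ by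
    rw [← extChartAt_source 𝓘(ℝ, E)]
    exact (extChartAt 𝓘(ℝ, E) x₀).map_target hz)
  exact (contMDiffOn_iff_contDiffOn.1 h2).of_le (by simp)

lemma chartMetric_self (x₀ : M) (v w : E) :
    chartMetric x₀ (extChartAt 𝓘(ℝ, E) x₀ x₀) v w
      = inner ℝ (ofChart x₀ x₀ v) (ofChart x₀ x₀ w) := by
  have h : (extChartAt 𝓘(ℝ, E) x₀).symm (extChartAt 𝓘(ℝ, E) x₀ x₀) = x₀ := by simp
  rw [chartMetric_apply, h]

lemma mvfderiv_inner_ofChart (x₀ : M) (v w : E) :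
    mvfderiv 𝓘(ℝ, E) (fun y ↦ inner ℝ (ofChart x₀ y v) (ofChart x₀ y v)) x₀ (ofChart x₀ x₀ w)
      = fderiv ℝ (chartMetric x₀) (extChartAt 𝓘(ℝ, E) x₀ x₀) w v v := by
  have hd : DifferentiableAt ℝ (chartMetric x₀) (extChartAt 𝓘(ℝ, E) x₀ x₀) :=
    ((contDiffOn_chartMetric x₀).contDiffAt ((isOpen_extChartAt_target_self x₀).mem_nhds
      (mem_extChartAt_target x₀))).differentiableAt one_ne_zero
  have hV := (contMDiffOn_ofChart x₀ v).contMDiffAt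
    ((chartAt E x₀).open_source.mem_nhds (mem_chart_source E x₀))
  have hm : MDifferentiableAt 𝓘(ℝ, E) 𝓘(ℝ, ℝ)
      (fun y ↦ inner ℝ (ofChart x₀ y v) (ofChart x₀ y v)) x₀ :=
    mdiff_inner (hV.mdifferentiableAt (by simp)) (hV.mdifferentiableAt (by simp))
  have e : HasFDerivAt (fun z ↦ chartMetric x₀ z v v)
      (((ContinuousLinearMap.apply ℝ ℝ v).comp (ContinuousLinearMap.apply ℝ (E →L[ℝ] ℝ) v)).comp
        (fderiv ℝ (chartMetric x₀) (extChartAt 𝓘(ℝ, E) x₀ x₀))) (extChartAt 𝓘(ℝ, E) x₀ x₀) :=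
    (((ContinuousLinearMap.apply ℝ ℝ v).comp
      (ContinuousLinearMap.apply ℝ (E →L[ℝ] ℝ) v)).hasFDerivAt).comp _ hd.hasFDerivAt
  have e' : HasMFDerivAt 𝓘(ℝ, E) 𝓘(ℝ, ℝ) (fun y ↦ inner ℝ (ofChart x₀ y v) (ofChart x₀ y v)) x₀
      (((ContinuousLinearMap.apply ℝ ℝ v).comp (ContinuousLinearMap.apply ℝ (E →L[ℝ] ℝ) v)).comp
        (fderiv ℝ (chartMetric x₀) (extChartAt 𝓘(ℝ, E) x₀ x₀)) : E →L[ℝ] ℝ) :=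
    ⟨hm.continuousAt, e.hasFDerivWithinAt⟩
  rw [ofChart_self]
  exact congrArg (fun L : E →L[ℝ] ℝ ↦ L w) e'.mfderiv

/-- The Lie bracket on `M` is defined by pulling back along the inverse chart; this identifies that
pullback with reading coordinates in the trivialization, as `chartField` does. -/
lemma inverse_mfderivWithin_extChartAt_symm {x₀ : M} {z : E}
    (hz : z ∈ (extChartAt 𝓘(ℝ, E) x₀).target) (u : TangentSpace 𝓘(ℝ, E)
      ((extChartAt 𝓘(ℝ, E) x₀).symm z)) :
    (mfderivWithin 𝓘(ℝ, E) 𝓘(ℝ, E) (extChartAt 𝓘(ℝ, E) x₀).symm (range 𝓘(ℝ, E)) z).inverse u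
      = (trivializationAt E (TangentSpace 𝓘(ℝ, E)) x₀
          ⟨(extChartAt 𝓘(ℝ, E) x₀).symm z, u⟩).2 := by
  have hy : (extChartAt 𝓘(ℝ, E) x₀).symm z ∈ (chartAt E x₀).source := by
    rw [← extChartAt_source 𝓘(ℝ, E)]
    exact (extChartAt 𝓘(ℝ, E) x₀).map_target hz
  have h1 := TangentBundle.symmL_trivializationAt (I := 𝓘(ℝ, E)) hy
  rw [(extChartAt 𝓘(ℝ, E) x₀).right_inv hz] at h1
  have hy' : (extChartAt 𝓘(ℝ, E) x₀).symm z ∈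
    (trivializationAt E (TangentSpace 𝓘(ℝ, E) : M → Type _) x₀).baseSet := hy
  have h2 := Trivialization.symm_continuousLinearEquivAt_eq' (R := ℝ) _ hy'
  have h3 : ∀ L : E →L[ℝ] TangentSpace 𝓘(ℝ, E) ((extChartAt 𝓘(ℝ, E) x₀).symm z),
      L = ((trivializationAt E (TangentSpace 𝓘(ℝ, E)) x₀).continuousLinearEquivAt ℝ _ hy').symm →
      L.inverse u = (trivializationAt E (TangentSpace 𝓘(ℝ, E)) x₀
          ⟨(extChartAt 𝓘(ℝ, E) x₀).symm z, u⟩).2 := by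
    rintro _ rfl
    rw [ContinuousLinearMap.inverse_equiv]
    rfl
  exact h3 _ (h1.symm.trans h2.symm)

/-- In the chart the first field is the constant `v`, so only the derivative of `X` along `v`
survives in the bracket. -/
lemma mlieBracket_ofChart {X : Π x : M, TangentSpace 𝓘(ℝ, E) x} (x₀ : M) (v : E) :
    mlieBracket 𝓘(ℝ, E) (fun y ↦ ofChart x₀ y v) X x₀
      = ofChart x₀ x₀ (fderiv ℝ (chartField X x₀) (extChartAt 𝓘(ℝ, E) x₀ x₀) v) := by
  have ht : (extChartAt 𝓘(ℝ, E) x₀).target ∈ 𝓝 (extChartAt 𝓘(ℝ, E) x₀ x₀) :=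
    (isOpen_extChartAt_target_self x₀).mem_nhds (mem_extChartAt_target x₀)
  have hV : mpullbackWithin 𝓘(ℝ, E) 𝓘(ℝ, E) (extChartAt 𝓘(ℝ, E) x₀).symm
      (fun y ↦ ofChart x₀ y v) (range 𝓘(ℝ, E)) =ᶠ[𝓝 (extChartAt 𝓘(ℝ, E) x₀ x₀)] fun _ ↦ v := by
    filter_upwards [ht] with z hz
    have hy : (extChartAt 𝓘(ℝ, E) x₀).symm z ∈ (chartAt E x₀).source := by
      rw [← extChartAt_source 𝓘(ℝ, E)]
      exact (extChartAt 𝓘(ℝ, E) x₀).map_target hz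
    exact (inverse_mfderivWithin_extChartAt_symm hz _).trans
      (trivializationAt_ofChart hy v)
  have hW : mpullbackWithin 𝓘(ℝ, E) 𝓘(ℝ, E) (extChartAt 𝓘(ℝ, E) x₀).symm
      X (range 𝓘(ℝ, E)) =ᶠ[𝓝 (extChartAt 𝓘(ℝ, E) x₀ x₀)] chartField X x₀ := by
    filter_upwards [ht] with z hz
    exact inverse_mfderivWithin_extChartAt_symm hz _
  have h := hV.lieBracket_vectorField_eq (𝕜 := ℝ) hW
  rw [ofChart_self, mlieBracket, mlieBracketWithin_apply, mfderiv_extChartAt_self]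
  refine (congrFun (congrArg DFunLike.coe (ContinuousLinearMap.inverse_id ..)) _).trans ?_
  simp only [preimage_univ, modelWithCornersSelf_coe, range_id, univ_inter] at h ⊢
  refine (congrFun lieBracketWithin_univ _).trans (h.trans ?_)
  simp [lieBracket]

/-- The Koszul formula for `g(∇_v X, v)` in the preferred chart at the base point. -/
lemma two_mul_inner_leviCivita {X : Π x : M, TangentSpace 𝓘(ℝ, E) x}
    (hX : ContMDiff 𝓘(ℝ, E) 𝓘(ℝ, E).tangent ∞ (fun x ↦ (⟨x, X x⟩ : TangentBundle 𝓘(ℝ, E) M)))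
    (x₀ : M) (v : E) :
    2 * inner ℝ (leviCivita E M X x₀ (ofChart x₀ x₀ v)) (ofChart x₀ x₀ v)
      = fderiv ℝ (chartMetric x₀) (extChartAt 𝓘(ℝ, E) x₀ x₀)
          (chartField X x₀ (extChartAt 𝓘(ℝ, E) x₀ x₀)) v v
        + 2 * chartMetric x₀ (extChartAt 𝓘(ℝ, E) x₀ x₀)
          (fderiv ℝ (chartField X x₀) (extChartAt 𝓘(ℝ, E) x₀ x₀) v) v := by
  have hV := ((contMDiffOn_ofChart x₀ v).contMDiffAt
    ((chartAt E x₀).open_source.mem_nhds (mem_chart_source E x₀))).mdifferentiableAt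
      (by simp : (∞ : WithTop ℕ∞) ≠ 0)
  have h := inner_nablaAt (hX.mdifferentiableAt (by simp)) hV hV
  have hXx : X x₀ = ofChart x₀ x₀ (chartField X x₀ (extChartAt 𝓘(ℝ, E) x₀ x₀)) := by
    have hx : (extChartAt 𝓘(ℝ, E) x₀).symm (extChartAt 𝓘(ℝ, E) x₀ x₀) = x₀ := by simp
    rw [chartField, hx]
    exact (ofChart_trivializationAt (mem_chart_source E x₀) (X x₀)).symm
  -- With `Y = Z = V` of constant coordinates, the terms `V g(X, V)` cancel and `[V, V] = 0`. There
  -- remains `X g(V, V) + 2 g([V, X], V)`, which is `(L_X g)(V, V)`.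
  rw [koszul, d_inner_comm X, mlieBracket_self, mlieBracket_swap_apply (V := X),
    mlieBracket_ofChart] at h
  rw [chartMetric_self, ← mvfderiv_inner_ofChart, ← hXx]
  change 2 * inner ℝ (nablaAt X x₀ (ofChart x₀ x₀ v)) (ofChart x₀ x₀ v) = _
  simp only [Pi.zero_apply, inner_zero_left, inner_neg_left] at h
  linarith

end ChartExpressions

/-! ### A first-order substitute for the distance -/

section ChartGauge

open Filter Topology Set Asymptotics

variable {E : Type*} [NormedAddCommGroup E] [NormedSpace ℝ E] [FiniteDimensional ℝ E]
  {M : Type*} [TopologicalSpace M] [ChartedSpace E M] [IsManifold 𝓘(ℝ, E) ∞ M]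
  [RiemannianBundle (fun x : M ↦ TangentSpace 𝓘(ℝ, E) x)]
  [IsContMDiffRiemannianBundle 𝓘(ℝ, E) ∞ E (fun x : M ↦ TangentSpace 𝓘(ℝ, E) x)]

variable (E) in
/-- The Riemannian length, at `x`, of the displacement from `x` to `y` in the preferred chart
at `x`. To first order, this is the distance from `x` to `y`. -/
noncomputable def chartGauge (x y : M) : ℝ :=
  ‖ofChart x x (extChartAt 𝓘(ℝ, E) x y - extChartAt 𝓘(ℝ, E) x x)‖

lemma chartGauge_nonneg (x y : M) : 0 ≤ chartGauge E x y := norm_nonneg _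

lemma exists_norm_le_mul_norm_ofChart {x₀ y : M} (hy : y ∈ (chartAt E x₀).source) :
    ∃ K > 0, ∀ v : E, ‖v‖ ≤ K * ‖ofChart x₀ y v‖ := by
  let L : TangentSpace 𝓘(ℝ, E) y →L[ℝ] E :=
    (trivializationAt E (TangentSpace 𝓘(ℝ, E)) x₀).continuousLinearMapAt ℝ y
  refine ⟨‖L‖ + 1, by positivity, fun v ↦ ?_⟩
  have h : L (ofChart x₀ y v) = v := Trivialization.continuousLinearMapAt_symmL _ hy v
  calc ‖v‖ = ‖L (ofChart x₀ y v)‖ := by rw [h]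
    _ ≤ ‖L‖ * ‖ofChart x₀ y v‖ := L.le_opNorm _
    _ ≤ (‖L‖ + 1) * ‖ofChart x₀ y v‖ := by gcongr; linarith

lemma exists_norm_ofChart_le (x₀ y : M) : ∃ K > 0, ∀ v : E, ‖ofChart x₀ y v‖ ≤ K * ‖v‖ := by
  exact (ofChart (E := E) x₀ y).bound

lemma chartMetric_apply_self {x₀ y : M} (hy : y ∈ (chartAt E x₀).source) (v : E) :
    chartMetric x₀ (extChartAt 𝓘(ℝ, E) x₀ y) v v = ‖ofChart x₀ y v‖ ^ 2 := by
  have h : (extChartAt 𝓘(ℝ, E) x₀).symm (extChartAt 𝓘(ℝ, E) x₀ y) = y :=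
    (extChartAt 𝓘(ℝ, E) x₀).left_inv (by rwa [extChartAt_source])
  rw [chartMetric_apply, h, real_inner_self_eq_norm_sq]

lemma exists_mul_sq_le_chartMetric (x₀ : M) : ∃ c > 0, ∀ v : E,
    c * ‖v‖ ^ 2 ≤ chartMetric x₀ (extChartAt 𝓘(ℝ, E) x₀ x₀) v v := by
  obtain ⟨K, hK, h⟩ := exists_norm_le_mul_norm_ofChart (E := E) (mem_chart_source E x₀)
  refine ⟨(K ^ 2)⁻¹, by positivity, fun v ↦ ?_⟩
  rw [chartMetric_apply_self (mem_chart_source E x₀), inv_mul_le_iff₀ (by positivity), ← mul_pow]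
  exact pow_le_pow_left₀ (norm_nonneg _) (h v) 2

/-- To first order at `y`, the gauge does not depend on the chart that is used to define it. -/
lemma chartGauge_isEquivalent {x₀ y : M} (hy : y ∈ (chartAt E x₀).source) :
    chartGauge E y ~[𝓝 y]
      fun y' ↦ ‖ofChart x₀ y (extChartAt 𝓘(ℝ, E) x₀ y' - extChartAt 𝓘(ℝ, E) x₀ y)‖ := by
  have hy' : y ∈ (extChartAt 𝓘(ℝ, E) x₀).source := by rwa [extChartAt_source]
  obtain ⟨K, hK, hKb⟩ := exists_norm_le_mul_norm_ofChart (E := E) hy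
  obtain ⟨K', hK', hKb'⟩ := exists_norm_ofChart_le (E := E) y y
  -- Displacements in the two charts differ by the derivative of the transition map, up to a
  -- little-o error; by `h3` this derivative is absorbed by changing `ofChart y y` into `ofChart x₀
  -- y`.
  have h1 := (hasFDerivWithinAt_tangentCoordChange (I := 𝓘(ℝ, E)) (x := x₀) (y := y) (z := y)
    ⟨hy', mem_extChartAt_source y⟩)
  rw [modelWithCornersSelf_coe, range_id, hasFDerivWithinAt_univ, hasFDerivAt_iff_isLittleO] at h1
  have h2 := h1.comp_tendsto (continuousAt_extChartAt' (I := 𝓘(ℝ, E)) hy')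
  have h3 : ∀ v, ofChart y y (tangentCoordChange 𝓘(ℝ, E) x₀ y y v) = ofChart x₀ y v := by
    intro v
    rw [ofChart_self, ofChart, TangentBundle.symmL_trivializationAt_eq_core hy]
    rfl
  have h4 : ∀ᶠ y' in 𝓝 y, y' ∈ (extChartAt 𝓘(ℝ, E) x₀).source :=
    extChartAt_source_mem_nhds' hy'
  refine IsLittleO.of_bound fun c hc ↦ ?_
  filter_upwards [h4, h2.def (c := c / (K * K')) (by positivity)] with y' hy4 hy2
  simp only [Function.comp_apply, (extChartAt 𝓘(ℝ, E) x₀).left_inv hy4,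
    (extChartAt 𝓘(ℝ, E) x₀).left_inv hy'] at hy2
  rw [Pi.sub_apply, norm_norm, chartGauge, ← h3]
  refine (abs_norm_sub_norm_le _ _).trans ?_
  rw [← map_sub, h3]
  refine (hKb' _).trans ?_
  calc _ ≤ K' * (c / (K * K') * (K * _)) := by
        gcongr
        exact hy2.trans (mul_le_mul_of_nonneg_left (hKb _) (by positivity))
    _ = _ := by field_simp

lemma chartGauge_self (x : M) : chartGauge E x x = 0 := by simp [chartGauge]

/-- The gauge is continuous at its base point. -/
lemma tendsto_chartGauge (x : M) : Tendsto (chartGauge E x) (𝓝 x) (𝓝 0) := by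
  have h : ContinuousAt (chartGauge E x) x :=
    ((ofChart x x).continuous.continuousAt.comp
      ((continuousAt_extChartAt (I := 𝓘(ℝ, E)) x).sub continuousAt_const)).norm
  simpa [ContinuousAt, chartGauge_self] using h

/-- The rate of change of the gauge along a differentiable curve is its speed. -/
lemma tendsto_chartGauge_div {γ : ℝ → M} {u : ℝ} (hγ : MDifferentiableAt 𝓘(ℝ, ℝ) 𝓘(ℝ, E) γ u) :
    Tendsto (fun u' ↦ (u' - u)⁻¹ * chartGauge E (γ u) (γ u')) (𝓝[>] u)
      (𝓝 ‖mfderiv 𝓘(ℝ, ℝ) 𝓘(ℝ, E) γ u 1‖) := by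
  have h1 := hγ.hasMFDerivAt.2
  obtain ⟨L, hL⟩ : ∃ L : ℝ →L[ℝ] E, L = mfderiv 𝓘(ℝ, ℝ) 𝓘(ℝ, E) γ u := ⟨_, rfl⟩
  rw [← hL] at h1
  have h2 : HasFDerivWithinAt (extChartAt 𝓘(ℝ, E) (γ u) ∘ γ) L (range 𝓘(ℝ, ℝ)) u := h1
  have h2 : HasDerivAt (extChartAt 𝓘(ℝ, E) (γ u) ∘ γ) (L 1) u :=
    (h2.hasFDerivAt (by simp)).hasDerivAt
  have h3 := (hasDerivAt_iff_tendsto_slope.1 h2).mono_left (nhdsGT_le_nhdsNE u)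
  have h4 := (((ofChart (γ u) (γ u)).continuous.tendsto _).comp h3).norm
  have h5 : ofChart (γ u) (γ u) (L 1) = mfderiv 𝓘(ℝ, ℝ) 𝓘(ℝ, E) γ u 1 :=
    (ofChart_self (γ u) (L 1)).trans (congrArg (fun L : ℝ →L[ℝ] E ↦ L 1) hL)
  rw [h5] at h4
  refine h4.congr' ?_
  filter_upwards [self_mem_nhdsWithin] with u' hu'
  have hp : 0 < u' - u := sub_pos.2 hu'
  simp only [Function.comp_apply, slope_def_module, map_smul, norm_smul, norm_inv, chartGauge,
    Real.norm_eq_abs, abs_of_pos hp]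

end ChartGauge

/-! ### Comparing the distance with the gauge, and finiteness of the distance -/

section DistanceAndLength

open Filter Topology Set Manifold MeasureTheory

variable {E : Type*} [NormedAddCommGroup E] [NormedSpace ℝ E] [FiniteDimensional ℝ E]
  {M : Type*} [TopologicalSpace M] [ChartedSpace E M] [IsManifold 𝓘(ℝ, E) ∞ M]
  [RiemannianBundle (fun x : M ↦ TangentSpace 𝓘(ℝ, E) x)]
  [IsContMDiffRiemannianBundle 𝓘(ℝ, E) ∞ E (fun x : M ↦ TangentSpace 𝓘(ℝ, E) x)]

lemma isContinuousRiemannianBundle_tangentSpace :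
    IsContinuousRiemannianBundle E (fun x : M ↦ TangentSpace 𝓘(ℝ, E) x) := by
  obtain ⟨g, hg, hg'⟩ := ‹IsContMDiffRiemannianBundle 𝓘(ℝ, E) ∞ E
    (fun x : M ↦ TangentSpace 𝓘(ℝ, E) x)›.exists_contMDiff
  exact ⟨g, hg.continuous, hg'⟩

/-- By continuity of the metric, a vector with fixed coordinates changes its length only slightly
near `x`. -/
lemma eventually_norm_ofChart_le (x : M) {η : ℝ} (hη : 1 < η) :
    ∀ᶠ y in 𝓝 x, ∀ v : E, ‖ofChart x y v‖ ≤ η * ‖ofChart x x v‖ := by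
  have := isContinuousRiemannianBundle_tangentSpace (E := E) (M := M)
  filter_upwards [eventually_norm_symmL_trivializationAt_comp_self_lt E
    (fun x : M ↦ TangentSpace 𝓘(ℝ, E) x) x hη] with y hy v
  have h1 : (trivializationAt E (TangentSpace 𝓘(ℝ, E)) x).continuousLinearMapAt ℝ x
      (ofChart x x v) = v :=
    Trivialization.continuousLinearMapAt_symmL _ (FiberBundle.mem_baseSet_trivializationAt' x) v
  have h2 := ContinuousLinearMap.le_of_opNorm_le _ hy.le (ofChart x x v)
  rwa [ContinuousLinearMap.comp_apply, h1] at h2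

/-- The inverse chart has derivative `ofChart`, so a straight segment has velocity with constant
coordinates `w - z`. -/
lemma mfderivWithin_extChartAt_symm_comp_lineMap {x : M} {z w : E} {t : ℝ} (ht : t ∈ Icc (0 : ℝ) 1)
    (h : ∀ s ∈ Icc (0 : ℝ) 1, AffineMap.lineMap z w s ∈ (extChartAt 𝓘(ℝ, E) x).target) :
    mfderivWithin 𝓘(ℝ, ℝ) 𝓘(ℝ, E)
      ((extChartAt 𝓘(ℝ, E) x).symm ∘ (AffineMap.lineMap z w : ℝ → E)) (Icc 0 1) t 1
      = ofChart x ((extChartAt 𝓘(ℝ, E) x).symm (AffineMap.lineMap z w t)) (w - z) := by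
  have hl : HasDerivAt (AffineMap.lineMap z w : ℝ → E) (w - z) t := AffineMap.hasDerivAt_lineMap
  have hy : (extChartAt 𝓘(ℝ, E) x).symm (AffineMap.lineMap z w t) ∈ (chartAt E x).source := by
    rw [← extChartAt_source 𝓘(ℝ, E)]
    exact (extChartAt 𝓘(ℝ, E) x).map_target (h t ht)
  have h1 := TangentBundle.symmL_trivializationAt (I := 𝓘(ℝ, E)) hy
  rw [(extChartAt 𝓘(ℝ, E) x).right_inv (h t ht)] at h1
  have hc : mfderivWithin 𝓘(ℝ, ℝ) 𝓘(ℝ, E)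
      ((extChartAt 𝓘(ℝ, E) x).symm ∘ (AffineMap.lineMap z w : ℝ → E)) (Icc 0 1) t =
      (mfderivWithin 𝓘(ℝ, E) 𝓘(ℝ, E) (extChartAt 𝓘(ℝ, E) x).symm (range 𝓘(ℝ, E))
        (AffineMap.lineMap z w t)) ∘L
      (mfderivWithin 𝓘(ℝ, ℝ) 𝓘(ℝ, E) (AffineMap.lineMap z w : ℝ → E) (Icc 0 1) t) := by
    apply mfderivWithin_comp
    · exact mdifferentiableWithinAt_extChartAt_symm (h t ht)
    · exact hl.differentiableAt.differentiableWithinAt.mdifferentiableWithinAt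
    · intro s _
      simp
    · rw [uniqueMDiffWithinAt_iff_uniqueDiffWithinAt]
      exact uniqueDiffOn_Icc zero_lt_one t ht
  have hd : mfderivWithin 𝓘(ℝ, ℝ) 𝓘(ℝ, E) (AffineMap.lineMap z w : ℝ → E) (Icc 0 1) t 1
      = w - z := by
    rw [mfderivWithin_eq_fderivWithin]
    exact hl.hasDerivWithinAt.derivWithin (uniqueDiffOn_Icc zero_lt_one t ht)
  rw [hc, ← h1]
  exact congrArg _ hd

/-- The Riemannian distance is at most the gauge, to first order. -/
lemma eventually_riemannianEDist_le_chartGauge (x : M) {η : ℝ} (hη : 1 < η) :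
    ∀ᶠ y in 𝓝 x, riemannianEDist 𝓘(ℝ, E) x y ≤ ENNReal.ofReal (η * chartGauge E x y) := by
  have h1 : ∀ᶠ z in 𝓝 (extChartAt 𝓘(ℝ, E) x x), z ∈ (extChartAt 𝓘(ℝ, E) x).target ∧
      ∀ v : E, ‖ofChart x ((extChartAt 𝓘(ℝ, E) x).symm z) v‖ ≤ η * ‖ofChart x x v‖ := by
    refine Eventually.and ((isOpen_extChartAt_target_self (E := E) x).mem_nhds
      (mem_extChartAt_target (I := 𝓘(ℝ, E)) x)) ?_
    have := continuousAt_extChartAt_symm (I := 𝓘(ℝ, E)) x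
    rw [ContinuousAt, extChartAt_to_inv] at this
    exact this.eventually (eventually_norm_ofChart_le x hη)
  obtain ⟨r, r_pos, hr⟩ := Metric.eventually_nhds_iff_ball.1 h1
  have h2 : ∀ᶠ y in 𝓝 x, extChartAt 𝓘(ℝ, E) x y ∈ Metric.ball (extChartAt 𝓘(ℝ, E) x x) r :=
    (continuousAt_extChartAt (I := 𝓘(ℝ, E)) x).eventually (Metric.ball_mem_nhds _ r_pos)
  filter_upwards [h2, extChartAt_source_mem_nhds (I := 𝓘(ℝ, E)) x] with y hy hy'
  set z := extChartAt 𝓘(ℝ, E) x x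
  set w := extChartAt 𝓘(ℝ, E) x y
  have hseg : ∀ s ∈ Icc (0 : ℝ) 1, AffineMap.lineMap z w s ∈ Metric.ball z r := by
    intro s hs
    refine (convex_ball z r).segment_subset (Metric.mem_ball_self r_pos) hy ?_
    rw [segment_eq_image_lineMap]
    exact mem_image_of_mem _ hs
  have hsm : ContMDiffOn 𝓘(ℝ, ℝ) 𝓘(ℝ, E) 1 (AffineMap.lineMap z w : ℝ → E) (Icc 0 1) :=
    (contMDiff_iff_contDiff.2 (ContinuousAffineMap.lineMap (R := ℝ) z w).contDiff).contMDiffOn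
  -- The competitor is the straight segment in the chart, whose speed is at most `η * chartGauge E x
  -- y` throughout.
  have hle : riemannianEDist 𝓘(ℝ, E) x y ≤ pathELength 𝓘(ℝ, E)
      ((extChartAt 𝓘(ℝ, E) x).symm ∘ (AffineMap.lineMap z w : ℝ → E)) 0 1 := by
    refine riemannianEDist_le_pathELength ?_ ?_ ?_ zero_le_one
    · exact (contMDiffOn_extChartAt_symm x).comp hsm fun s hs ↦ (hr _ (hseg s hs)).1
    · simp [z]
    · simp only [Function.comp_apply, AffineMap.lineMap_apply_one, w]
      exact (extChartAt 𝓘(ℝ, E) x).left_inv hy'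
  refine hle.trans ?_
  rw [pathELength_eq_lintegral_mfderivWithin_Icc]
  calc _ ≤ ∫⁻ _ in Icc (0 : ℝ) 1, ENNReal.ofReal (η * chartGauge E x y) := by
        refine setLIntegral_mono' measurableSet_Icc fun t ht ↦ ?_
        rw [mfderivWithin_extChartAt_symm_comp_lineMap ht fun s hs ↦ (hr _ (hseg s hs)).1,
          ← ofReal_norm]
        exact ENNReal.ofReal_le_ofReal ((hr _ (hseg t ht)).2 _)
    _ = _ := by simp

lemma continuous_speed {γ : ℝ → M} (hγ : ContMDiff 𝓘(ℝ, ℝ) 𝓘(ℝ, E) 1 γ) :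
    Continuous fun u ↦ ‖mfderiv 𝓘(ℝ, ℝ) 𝓘(ℝ, E) γ u 1‖ := by
  have := isContinuousRiemannianBundle_tangentSpace (E := E) (M := M)
  have h1 : Continuous fun u : ℝ ↦ (⟨γ u, mfderiv 𝓘(ℝ, ℝ) 𝓘(ℝ, E) γ u 1⟩ :
      TangentBundle 𝓘(ℝ, E) M) := by
    have h2 : Continuous fun u : ℝ ↦ (⟨u, 1⟩ : TangentBundle 𝓘(ℝ, ℝ) ℝ) :=
      (tangentBundleModelSpaceHomeomorph 𝓘(ℝ, ℝ)).symm.continuous.comp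
        (continuous_id.prodMk continuous_const)
    exact (hγ.continuous_tangentMap le_rfl).comp h2
  have h3 := (Continuous.inner_bundle (F := E) (E := fun x : M ↦ TangentSpace 𝓘(ℝ, E) x)
    h1 h1).sqrt
  simpa only [← norm_eq_sqrt_real_inner] using h3

lemma pathELength_eq_ofReal_integral {γ : ℝ → M} (hγ : ContMDiff 𝓘(ℝ, ℝ) 𝓘(ℝ, E) 1 γ)
    {a b : ℝ} (hab : a ≤ b) : pathELength 𝓘(ℝ, E) γ a b
      = ENNReal.ofReal (∫ u in a..b, ‖mfderiv 𝓘(ℝ, ℝ) 𝓘(ℝ, E) γ u 1‖) := by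
  rw [pathELength_eq_lintegral_mfderiv_Icc, intervalIntegral.integral_of_le hab,
    ← integral_Icc_eq_integral_Ioc, ofReal_integral_eq_lintegral_ofReal]
  · simp only [ofReal_norm]
  · exact (continuous_speed hγ).continuousOn.integrableOn_Icc
  · exact ae_of_all _ fun _ ↦ norm_nonneg _

/-- Nearby points are at finite distance, so by the triangle inequality the points at finite
distance from `x` form a nonempty clopen set. -/
lemma riemannianEDist_ne_top [ConnectedSpace M] (x y : M) :
    riemannianEDist 𝓘(ℝ, E) x y ≠ ⊤ := by
  have := isContinuousRiemannianBundle_tangentSpace (E := E) (M := M)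
  have : IsManifold 𝓘(ℝ, E) 1 M := .of_le (n := ∞) (by simp)
  have hnhds : ∀ y : M, ∀ᶠ z in 𝓝 y, riemannianEDist 𝓘(ℝ, E) y z < 1 :=
    fun y ↦ eventually_riemannianEDist_lt 𝓘(ℝ, E) y one_pos
  have hclopen : IsClopen {y | riemannianEDist 𝓘(ℝ, E) x y ≠ ⊤} := by
    constructor
    · rw [← isOpen_compl_iff, isOpen_iff_mem_nhds]
      intro y hy
      filter_upwards [hnhds y] with z hz hxz
      refine hy (ne_top_of_le_ne_top (ENNReal.add_ne_top.2 ⟨hxz, ?_⟩)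
        (riemannianEDist_triangle (y := z)))
      rw [riemannianEDist_comm]
      exact hz.ne_top
    · rw [isOpen_iff_mem_nhds]
      intro y hy
      filter_upwards [hnhds y] with z hz
      exact ne_top_of_le_ne_top (ENNReal.add_ne_top.2 ⟨hy, hz.ne_top⟩)
        (riemannianEDist_triangle (y := y))
  have hx : x ∈ {y | riemannianEDist 𝓘(ℝ, E) x y ≠ ⊤} := by simp [riemannianEDist_self]
  have := hclopen.eq_univ ⟨x, hx⟩
  exact this.ge (mem_univ y)

end DistanceAndLength

/-! ### Infinitesimal stretch bounds -/

section InfinitesimalGrowth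

open Filter Topology Set Manifold Asymptotics

variable {E : Type*} [NormedAddCommGroup E] [NormedSpace ℝ E] [FiniteDimensional ℝ E]
  {M : Type*} [TopologicalSpace M] [ChartedSpace E M] [IsManifold 𝓘(ℝ, E) ∞ M]
  [RiemannianBundle (fun x : M ↦ TangentSpace 𝓘(ℝ, E) x)]
  [IsContMDiffRiemannianBundle 𝓘(ℝ, E) ∞ E (fun x : M ↦ TangentSpace 𝓘(ℝ, E) x)]

variable (E) in
/-- The map `f` is continuous at `y` and, infinitesimally at `y`, stretches distances by a factor
of at most `K`. -/
def HasStretchAt (f : M → M) (y : M) (K : ℝ) : Prop :=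
  ContinuousAt f y ∧ ∀ K' > K, ∀ᶠ y' in 𝓝 y, chartGauge E (f y) (f y') ≤ K' * chartGauge E y y'

lemma HasStretchAt.comp {f g : M → M} {y : M} {K L : ℝ} (hg : HasStretchAt E g (f y) L)
    (hf : HasStretchAt E f y K) (hK : 0 < K) (hL : 0 < L) :
    HasStretchAt E (g ∘ f) y (L * K) := by
  refine ⟨hg.1.comp hf.1, fun K' hK' ↦ ?_⟩
  -- `K' > L * K` is split as `(K' / K₁) * K₁` with `K₁ > K` for `f` and `K' / K₁ > L` for `g`.
  obtain ⟨K₁, hK₁, hK₁'⟩ := exists_between ((lt_div_iff₀' hL).2 hK')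
  have hK₁0 : 0 < K₁ := hK.trans hK₁
  have hL₁ : K' / K₁ > L := (lt_div_iff₀ hK₁0).2 ((lt_div_iff₀' hL).1 hK₁')
  filter_upwards [hf.2 K₁ hK₁, hf.1.eventually (hg.2 _ hL₁)] with y' h1 h2
  calc _ ≤ K' / K₁ * chartGauge E (f y) (f y') := h2
    _ ≤ K' / K₁ * (K₁ * chartGauge E y y') :=
        mul_le_mul_of_nonneg_left h1 (hL.trans hL₁).le
    _ = _ := by field_simp

lemma HasStretchAt.of_forall_gt {f : M → M} {y : M} {K : ℝ}
    (h : ∀ L > K, ∃ K' < L, HasStretchAt E f y K') : HasStretchAt E f y K := by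
  obtain ⟨_, _, hc, _⟩ := h (K + 1) (by linarith)
  refine ⟨hc, fun L hL ↦ ?_⟩
  obtain ⟨K', hK', -, h2⟩ := h L hL
  exact h2 L hK'

lemma HasStretchAt.eventually_riemannianEDist_le {f : M → M} {y : M} {K K' : ℝ}
    (hf : HasStretchAt E f y K) (hK : 0 < K) (hK' : K < K') :
    ∀ᶠ y' in 𝓝 y, riemannianEDist 𝓘(ℝ, E) (f y) (f y')
      ≤ ENNReal.ofReal (K' * chartGauge E y y') := by
  obtain ⟨K₁, h1, h2⟩ := exists_between hK'
  have hη : 1 < K' / K₁ := (one_lt_div (hK.trans h1)).2 h2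
  filter_upwards [hf.2 K₁ h1, hf.1.eventually (eventually_riemannianEDist_le_chartGauge (E := E) _ hη)]
    with y' h3 h4
  refine h4.trans (ENNReal.ofReal_le_ofReal ?_)
  calc _ ≤ K' / K₁ * (K₁ * chartGauge E y y') :=
        mul_le_mul_of_nonneg_left h3 (zero_le_one.trans hη.le)
    _ = _ := by have := (hK.trans h1).ne'; field_simp

lemma eventually_le_mul_of_isEquivalent {α : Type*} {l : Filter α} {u v : α → ℝ} (h : u ~[l] v)
    (hv : ∀ a, 0 ≤ v a) {η : ℝ} (hη : 1 < η) : ∀ᶠ a in l, u a ≤ η * v a := by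
  filter_upwards [h.isLittleO.def (sub_pos.2 hη)] with a ha
  rw [Pi.sub_apply, Real.norm_eq_abs, Real.norm_eq_abs, abs_of_nonneg (hv a)] at ha
  linarith [le_abs_self (u a - v a)]

/-- A growth bound in the chart at `x₀` gives an infinitesimal growth bound. -/
lemma hasStretchAt_of_chart {x₀ y : M} {f : M → M} {K : ℝ} (hK : 0 < K)
    (hy : y ∈ (chartAt E x₀).source) (hf : ∀ᶠ y' in 𝓝 y, f y' ∈ (chartAt E x₀).source ∧
      ‖ofChart x₀ (f y) (extChartAt 𝓘(ℝ, E) x₀ (f y') - extChartAt 𝓘(ℝ, E) x₀ (f y))‖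
        ≤ K * ‖ofChart x₀ y (extChartAt 𝓘(ℝ, E) x₀ y' - extChartAt 𝓘(ℝ, E) x₀ y)‖) :
    HasStretchAt E f y K := by
  have hfy : f y ∈ (chartAt E x₀).source := hf.self_of_nhds.1
  have hy' : y ∈ (extChartAt 𝓘(ℝ, E) x₀).source := by rwa [extChartAt_source]
  have hfy' : f y ∈ (extChartAt 𝓘(ℝ, E) x₀).source := by rwa [extChartAt_source]
  -- The bound forces the coordinates of `f y'` to converge to those of `f y`; since `f y'` stays in
  -- the chart domain, so do the points.
  have hc : ContinuousAt f y := by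
    obtain ⟨L, hL, hLb⟩ := exists_norm_le_mul_norm_ofChart (E := E) hfy
    have h1 : Tendsto (fun y' ↦ L * (K * ‖ofChart x₀ y
        (extChartAt 𝓘(ℝ, E) x₀ y' - extChartAt 𝓘(ℝ, E) x₀ y)‖)) (𝓝 y) (𝓝 0) := by
      have h0 : ContinuousAt (fun y' ↦ L * (K * ‖ofChart x₀ y
        (extChartAt 𝓘(ℝ, E) x₀ y' - extChartAt 𝓘(ℝ, E) x₀ y)‖)) y :=
        continuousAt_const.mul (continuousAt_const.mul
          ((ofChart x₀ y).continuous.continuousAt.comp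
            ((continuousAt_extChartAt' (I := 𝓘(ℝ, E)) hy').sub continuousAt_const)).norm)
      simpa [ContinuousAt] using h0
    have h2 : Tendsto (fun y' ↦ extChartAt 𝓘(ℝ, E) x₀ (f y')) (𝓝 y)
        (𝓝 (extChartAt 𝓘(ℝ, E) x₀ (f y))) := by
      rw [tendsto_iff_norm_sub_tendsto_zero]
      refine squeeze_zero' (Eventually.of_forall fun _ ↦ norm_nonneg _) ?_ h1
      filter_upwards [hf] with y' h
      exact (hLb _).trans (mul_le_mul_of_nonneg_left h.2 hL.le)
    have h3 := (continuousAt_extChartAt_symm' (I := 𝓘(ℝ, E)) hfy').tendsto.comp h2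
    rw [(extChartAt 𝓘(ℝ, E) x₀).left_inv hfy'] at h3
    refine h3.congr' ?_
    filter_upwards [hf] with y' h
    exact (extChartAt 𝓘(ℝ, E) x₀).left_inv (by rw [extChartAt_source]; exact h.1)
  refine ⟨hc, fun K' hK' ↦ ?_⟩
  -- `K' = (K₁ / K) * K * (K' / K₁)`: the two factors above `1` pay for passing between the chart at
  -- `x₀` and the gauges at `f y` and at `y`.
  obtain ⟨K₁, h1, h2⟩ := exists_between hK'
  have hK₁ : 0 < K₁ := hK.trans h1
  have e1 := hc.eventually (eventually_le_mul_of_isEquivalent (chartGauge_isEquivalent hfy)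
    (fun _ ↦ norm_nonneg _) ((one_lt_div hK).2 h1))
  have e2 := eventually_le_mul_of_isEquivalent (chartGauge_isEquivalent hy).symm
    (fun _ ↦ norm_nonneg _) ((one_lt_div hK₁).2 h2)
  filter_upwards [e1, e2, hf] with y' h3 h4 h5
  calc _ ≤ K₁ / K * _ := h3
    _ ≤ K₁ / K * (K * (K' / K₁ * chartGauge E y y')) :=
        mul_le_mul_of_nonneg_left (h5.2.trans (mul_le_mul_of_nonneg_left h4 hK.le)) (by positivity)
    _ = _ := by field_simp

end InfinitesimalGrowth

/-! ### Integral curves in a chart -/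

section Flow

open Filter Topology Set Manifold

variable {E : Type*} [NormedAddCommGroup E] [NormedSpace ℝ E] [FiniteDimensional ℝ E]
  {M : Type*} [TopologicalSpace M] [ChartedSpace E M] [IsManifold 𝓘(ℝ, E) ∞ M]

/-- An integral curve in a chart solves the ODE of the expression of the vector field. -/
lemma IsMIntegralCurve.hasDerivAt_chart {X : Π x : M, TangentSpace 𝓘(ℝ, E) x} {γ : ℝ → M}
    (hγ : IsMIntegralCurve γ X) {x₀ : M} {t : ℝ} (ht : γ t ∈ (chartAt E x₀).source) :
    HasDerivAt (fun s ↦ extChartAt 𝓘(ℝ, E) x₀ (γ s))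
      (chartField X x₀ (extChartAt 𝓘(ℝ, E) x₀ (γ t))) t := by
  have h1 := ((mdifferentiableAt_extChartAt (I := 𝓘(ℝ, E)) ht).hasMFDerivAt.comp t (hγ t))
  rw [← TangentBundle.continuousLinearMapAt_trivializationAt (I := 𝓘(ℝ, E)) ht] at h1
  obtain ⟨L, hL⟩ : ∃ L : ℝ →L[ℝ] E, L =
      ((trivializationAt E (TangentSpace 𝓘(ℝ, E)) x₀).continuousLinearMapAt ℝ (γ t)).comp
        (ContinuousLinearMap.smulRight (1 : ℝ →L[ℝ] ℝ) (X (γ t))) := ⟨_, rfl⟩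
  have h2 : HasFDerivAt (fun s ↦ extChartAt 𝓘(ℝ, E) x₀ (γ s)) L t :=
    hL ▸ hasMFDerivAt_iff_hasFDerivAt.1 h1
  refine h2.hasDerivAt.congr_deriv ?_
  have h3 : (extChartAt 𝓘(ℝ, E) x₀).symm (extChartAt 𝓘(ℝ, E) x₀ (γ t)) = γ t :=
    (extChartAt 𝓘(ℝ, E) x₀).left_inv (by rwa [extChartAt_source])
  rw [chartField, h3, hL]
  exact (congrArg _ (one_smul ℝ (X (γ t)))).trans
    (Trivialization.continuousLinearMapAt_apply_of_mem (R := ℝ)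
      (trivializationAt E (TangentSpace 𝓘(ℝ, E)) x₀) ht (X (γ t)))

end Flow

/-! ### Stretch of the flow and the Lipschitz bound -/

section FlowStretch

open Filter Topology Set Manifold

variable {E : Type*} [NormedAddCommGroup E] [NormedSpace ℝ E] [FiniteDimensional ℝ E]
  {M : Type*} [TopologicalSpace M] [ChartedSpace E M] [IsManifold 𝓘(ℝ, E) ∞ M]

/-- Integral curves that start near `x₀` stay near `x₀` for a uniform time. -/
lemma exists_forall_mem_nhds_of_isMIntegralCurve [T2Space M]
    {X : Π x : M, TangentSpace 𝓘(ℝ, E) x}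
    (hX : ContMDiff 𝓘(ℝ, E) 𝓘(ℝ, E).tangent ∞ (fun x ↦ (⟨x, X x⟩ : TangentBundle 𝓘(ℝ, E) M)))
    (x₀ : M) {U : Set E} (hU : U ∈ 𝓝 (extChartAt 𝓘(ℝ, E) x₀ x₀)) :
    ∃ δ > 0, ∃ W ∈ 𝓝 x₀, ∀ γ : ℝ → M, IsMIntegralCurve γ X → γ 0 ∈ W → ∀ t ∈ Icc 0 δ,
      γ t ∈ (chartAt E x₀).source ∧ extChartAt 𝓘(ℝ, E) x₀ (γ t) ∈ U := by
  set z₀ := extChartAt 𝓘(ℝ, E) x₀ x₀ with hz₀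
  have ht : (extChartAt 𝓘(ℝ, E) x₀).target ∈ 𝓝 z₀ :=
    (isOpen_extChartAt_target_self x₀).mem_nhds (mem_extChartAt_target x₀)
  have hF : ContinuousAt (chartField X x₀) z₀ :=
    (contDiffOn_chartField hX x₀).continuousOn.continuousAt ht
  set B := ‖chartField X x₀ z₀‖ + 1 with hB
  have hBpos : 0 < B := by positivity
  have hb : ∀ᶠ z in 𝓝 z₀, ‖chartField X x₀ z‖ < B := hF.norm.eventually_lt_const (lt_add_one _)
  obtain ⟨R, hR, hRs⟩ := Metric.nhds_basis_closedBall.mem_iff.1 (inter_mem (inter_mem ht hU) hb)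
  set A := (extChartAt 𝓘(ℝ, E) x₀).symm '' Metric.closedBall z₀ R with hA
  have hAcl : IsClosed A := by
    have : ProperSpace E := FiniteDimensional.proper ℝ E
    refine ((isCompact_closedBall z₀ R).image_of_continuousOn ?_).isClosed
    exact (continuousOn_extChartAt_symm x₀).mono fun z hz ↦ (hRs hz).1.1
  have hAmem : ∀ y ∈ A, y ∈ (extChartAt 𝓘(ℝ, E) x₀).source ∧
      extChartAt 𝓘(ℝ, E) x₀ y ∈ Metric.closedBall z₀ R := by
    rintro _ ⟨z, hz, rfl⟩
    have hzt := (hRs hz).1.1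
    exact ⟨(extChartAt 𝓘(ℝ, E) x₀).map_target hzt,
      by rwa [(extChartAt 𝓘(ℝ, E) x₀).right_inv hzt]⟩
  have hmemA : ∀ y ∈ (extChartAt 𝓘(ℝ, E) x₀).source,
      extChartAt 𝓘(ℝ, E) x₀ y ∈ Metric.closedBall z₀ R → y ∈ A := fun y hy hy' ↦
    ⟨_, hy', (extChartAt 𝓘(ℝ, E) x₀).left_inv hy⟩
  -- A curve starting within `R / 2` of the centre with coordinate speed below `B` needs at least
  -- time `R / 2 / B` to leave the ball of radius `R`.
  refine ⟨R / 2 / B, by positivity, _, inter_mem (extChartAt_source_mem_nhds (I := 𝓘(ℝ, E)) x₀)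
    ((continuousAt_extChartAt (I := 𝓘(ℝ, E)) x₀).preimage_mem_nhds
      (Metric.closedBall_mem_nhds _ (half_pos hR))), ?_⟩
  rintro γ hγ ⟨hγs, hγ0⟩
  set S := {t ∈ γ ⁻¹' A | ‖extChartAt 𝓘(ℝ, E) x₀ (γ t) - z₀‖ ≤ R / 2 + B * t} with hS
  have hScl : IsClosed S := by
    refine (hAcl.preimage hγ.continuous).isClosed_le ?_ (by fun_prop)
    refine ContinuousOn.norm (ContinuousOn.sub ?_ continuousOn_const)
    exact (continuousOn_extChartAt x₀).comp hγ.continuous.continuousOn fun t ht ↦ (hAmem _ ht).1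
  have h0 : (0 : ℝ) ∈ S := by
    have h1 : ‖extChartAt 𝓘(ℝ, E) x₀ (γ 0) - z₀‖ ≤ R / 2 := mem_closedBall_iff_norm.1 hγ0
    refine ⟨hmemA _ hγs (Metric.closedBall_subset_closedBall (by linarith) hγ0), ?_⟩
    simpa using h1
  have hsub : Icc 0 (R / 2 / B) ⊆ S := by
    -- Continuation: `S` is closed, using that the compact set `A` is closed in the Hausdorff space
    -- `M`, and it can be extended to the right from each of its times before `R / 2 / B`.
    refine (hScl.inter isClosed_Icc).Icc_subset_of_forall_mem_nhdsWithin h0 ?_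
    rintro t ⟨⟨htA, htn⟩, ht0, htδ⟩
    obtain ⟨hts, htR⟩ := hAmem _ htA
    have hts' : γ t ∈ (chartAt E x₀).source := by rwa [← extChartAt_source 𝓘(ℝ, E)]
    have hd := hγ.hasDerivAt_chart hts'
    have htlt : ‖extChartAt 𝓘(ℝ, E) x₀ (γ t) - z₀‖ < R := by
      have := (lt_div_iff₀' hBpos).1 htδ
      linarith
    have e1 : ∀ᶠ s in 𝓝[>] t, γ s ∈ (extChartAt 𝓘(ℝ, E) x₀).source :=
      nhdsWithin_le_nhds (hγ.continuous.continuousAt.eventually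
        ((isOpen_extChartAt_source x₀).mem_nhds hts))
    have e2 : ∀ᶠ s in 𝓝[>] t, ‖extChartAt 𝓘(ℝ, E) x₀ (γ s) - z₀‖ < R :=
      nhdsWithin_le_nhds ((hd.continuousAt.sub continuousAt_const).norm.eventually_lt_const htlt)
    have e3 := (hd.hasDerivWithinAt (s := Ioi t)).limsup_norm_slope_le (hRs htR).2
    filter_upwards [e1, e2, e3, self_mem_nhdsWithin] with s h1 h2 h3 hs
    refine ⟨hmemA _ h1 (mem_closedBall_iff_norm.2 h2.le), ?_⟩
    have hst : 0 < s - t := sub_pos.2 hs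
    rw [Real.norm_of_nonneg hst.le, inv_mul_lt_iff₀ hst] at h3
    calc _ = ‖(extChartAt 𝓘(ℝ, E) x₀ (γ s) - extChartAt 𝓘(ℝ, E) x₀ (γ t))
          + (extChartAt 𝓘(ℝ, E) x₀ (γ t) - z₀)‖ := by rw [sub_add_sub_cancel]
      _ ≤ _ := norm_add_le _ _
      _ ≤ _ := by linarith
  intro t ht
  obtain ⟨h1, h2⟩ := hAmem _ (hsub ht).1
  exact ⟨by rwa [← extChartAt_source 𝓘(ℝ, E)], (hRs h2).1.2⟩

variable
  [RiemannianBundle (fun x : M ↦ TangentSpace 𝓘(ℝ, E) x)]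
  [IsContMDiffRiemannianBundle 𝓘(ℝ, E) ∞ E (fun x : M ↦ TangentSpace 𝓘(ℝ, E) x)]

/-- Near any point, for a short time, the flow stretches distances by at most `exp ((C + ε) t)`. -/
lemma exists_local_stretch [T2Space M] {X : Π x : M, TangentSpace 𝓘(ℝ, E) x}
    (hX : ContMDiff 𝓘(ℝ, E) 𝓘(ℝ, E).tangent ∞ (fun x ↦ (⟨x, X x⟩ : TangentBundle 𝓘(ℝ, E) M)))
    {C : ℝ} (hC : ∀ x, ‖leviCivita E M X x‖ ≤ C) {φ : ℝ → M → M} (hφ0 : ∀ x, φ 0 x = x)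
    (hφ : ∀ x, IsMIntegralCurve (φ · x) X) (x₀ : M) {ε : ℝ} (hε : 0 < ε) :
    ∃ δ > 0, ∃ W ∈ 𝓝 x₀, ∀ y ∈ W, ∀ t ∈ Icc 0 δ,
      HasStretchAt E (φ t) y (Real.exp ((C + ε) * t)) := by
  set z₀ := extChartAt 𝓘(ℝ, E) x₀ x₀ with hz₀
  have ht : (extChartAt 𝓘(ℝ, E) x₀).target ∈ 𝓝 z₀ :=
    (isOpen_extChartAt_target_self x₀).mem_nhds (mem_extChartAt_target x₀)
  have hF := (contDiffOn_chartField hX x₀).contDiffAt ht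
  have hg := (contDiffOn_chartMetric x₀).contDiffAt ht
  obtain ⟨c, hc, hpos⟩ := exists_mul_sq_le_chartMetric (E := E) x₀
  have hsymm : ∀ v w, chartMetric x₀ z₀ v w = chartMetric x₀ z₀ w v := fun v w ↦ by
    rw [chartMetric_self, chartMetric_self, real_inner_comm]
  have hC' : ∀ v, fderiv ℝ (chartMetric x₀) z₀ (chartField X x₀ z₀) v v
      + chartMetric x₀ z₀ (fderiv ℝ (chartField X x₀) z₀ v) v
      + chartMetric x₀ z₀ v (fderiv ℝ (chartField X x₀) z₀ v)
        ≤ 2 * C * chartMetric x₀ z₀ v v := by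
    -- The left side is `(L_X g)(v, v) = 2 g(∇_v X, v)`, bounded by Cauchy–Schwarz and the operator
    -- norm.
    intro v
    have h1 := two_mul_inner_leviCivita hX x₀ v
    have h2 : inner ℝ (leviCivita E M X x₀ (ofChart x₀ x₀ v)) (ofChart x₀ x₀ v)
        ≤ C * chartMetric x₀ z₀ v v := by
      rw [chartMetric_self, real_inner_self_eq_norm_sq]
      refine (real_inner_le_norm _ _).trans ?_
      rw [sq, ← mul_assoc]
      gcongr
      exact ContinuousLinearMap.le_of_opNorm_le _ (hC x₀) _
    rw [hsymm v]
    linarith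
  obtain ⟨U, hU, hUg⟩ := exists_nhds_growth (hF.hasStrictFDerivAt one_ne_zero) hg hc hpos hC' hε
  obtain ⟨δ, hδ, W, hW, hWs⟩ := exists_forall_mem_nhds_of_isMIntegralCurve hX x₀ hU
  refine ⟨δ, hδ, interior W, interior_mem_nhds.2 hW, fun y hy t ht ↦ ?_⟩
  have hs : ∀ y' ∈ W, ∀ s ∈ Icc 0 δ, φ s y' ∈ (chartAt E x₀).source ∧
      extChartAt 𝓘(ℝ, E) x₀ (φ s y') ∈ U := fun y' hy' ↦
    hWs (φ · y') (hφ y') (by rwa [hφ0])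
  have hs0 : ∀ y' ∈ W, y' ∈ (chartAt E x₀).source := fun y' hy' ↦ by
    simpa only [hφ0] using (hs y' hy' 0 ⟨le_rfl, hδ.le⟩).1
  have hyW := interior_subset hy
  refine hasStretchAt_of_chart (x₀ := x₀) (Real.exp_pos _) (hs0 y hyW) ?_
  filter_upwards [mem_interior_iff_mem_nhds.1 hy] with y' hy'
  refine ⟨(hs y' hy' t ht).1, ?_⟩
  -- The metric is taken along the orbit of `y`, so both sides are squared norms at `φ t y` and at
  -- `y`, as `hasStretchAt_of_chart` requires.
  have key := sq_length_le_exp_mul (κ := C + ε) (T := δ) (fun z hz ↦ (hUg z hz).1)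
    (fun z hz ↦ (hUg z hz).2.2)
    (a := fun s ↦ extChartAt 𝓘(ℝ, E) x₀ (φ s y)) (b := fun s ↦ extChartAt 𝓘(ℝ, E) x₀ (φ s y'))
    (fun s hs' ↦ ⟨(hs y hyW s hs').2, (hφ y).hasDerivAt_chart (hs y hyW s hs').1⟩)
    (fun s hs' ↦ ⟨(hs y' hy' s hs').2, (hφ y').hasDerivAt_chart (hs y' hy' s hs').1⟩) ht
  rw [chartMetric_apply_self (hs y hyW t ht).1, hφ0, hφ0, chartMetric_apply_self (hs0 y hyW),
    show 2 * (C + ε) * t = (C + ε) * t + (C + ε) * t by ring, Real.exp_add, ← sq, ← mul_pow] at key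
  exact (pow_le_pow_iff_left₀ (norm_nonneg _) (by positivity) two_ne_zero).1 key

/-- The time `t` map of the flow stretches distances by at most `exp ((C + ε) t)`. -/
lemma hasStretchAt_flow_add [T2Space M] {X : Π x : M, TangentSpace 𝓘(ℝ, E) x}
    (hX : ContMDiff 𝓘(ℝ, E) 𝓘(ℝ, E).tangent ∞ (fun x ↦ (⟨x, X x⟩ : TangentBundle 𝓘(ℝ, E) M)))
    {C : ℝ} (hC : ∀ x, ‖leviCivita E M X x‖ ≤ C) {φ : ℝ → M → M} (hφ0 : ∀ x, φ 0 x = x)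
    (hφ : ∀ x, IsMIntegralCurve (φ · x) X) (hadd : ∀ s t x, φ (s + t) x = φ s (φ t x))
    (x : M) {ε : ℝ} (hε : 0 < ε) {T : ℝ} (hT : 0 ≤ T) :
    HasStretchAt E (φ T) x (Real.exp ((C + ε) * T)) := by
  choose δ hδ W hW h using fun x₀ ↦ exists_local_stretch hX hC hφ0 hφ x₀ hε
  -- The radius `δ / 2` keeps two times in the same set less than `δ` apart, so the local bound
  -- covers the whole step between them.
  let c : Icc 0 T → Set (Icc 0 T) := fun t₀ ↦
    {s | φ s x ∈ interior (W (φ t₀ x)) ∧ |(s : ℝ) - t₀| < δ (φ t₀ x) / 2}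
  have hcont : Continuous fun s : Icc 0 T ↦ φ s x := (hφ x).continuous.comp continuous_subtype_val
  obtain ⟨t, ht0, htm, ⟨m, hm⟩, htc⟩ := exists_monotone_Icc_subset_open_cover_Icc hT (c := c)
    (fun t₀ ↦ (isOpen_interior.preimage hcont).inter
      (isOpen_lt (continuous_subtype_val.sub continuous_const).abs continuous_const))
    (fun t₀ _ ↦ mem_iUnion.2 ⟨t₀, mem_interior_iff_mem_nhds.2 (hW _), by simpa using hδ _⟩)
  have hind : ∀ n, HasStretchAt E (φ (t n)) x (Real.exp ((C + ε) * t n)) := by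
    intro n
    induction n with
    | zero =>
      rw [ht0, mul_zero, Real.exp_zero]
      have h0 : φ 0 = id := funext hφ0
      rw [h0]
      refine ⟨continuousAt_id, fun K' hK' ↦ Eventually.of_forall fun y' ↦ ?_⟩
      exact le_mul_of_one_le_left (chartGauge_nonneg _ _) hK'.le
    | succ n ih =>
      obtain ⟨t₀, ht₀⟩ := htc n
      have hle : t n ≤ t (n + 1) := htm n.le_succ
      have hle' : (t n : ℝ) ≤ t (n + 1) := hle
      obtain ⟨h1, h1'⟩ := ht₀ ⟨le_rfl, hle⟩
      obtain ⟨-, h2'⟩ := ht₀ ⟨hle, le_rfl⟩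
      have h3 := h _ _ (interior_subset h1) (t (n + 1) - t n) ⟨by linarith, by
        linarith [(abs_lt.1 h1').1, (abs_lt.1 h2').2]⟩
      have h4 := h3.comp ih (Real.exp_pos _) (Real.exp_pos _)
      rw [← Real.exp_add, ← mul_add, sub_add_cancel] at h4
      convert h4 using 1
      funext y
      rw [Function.comp_apply, ← hadd, sub_add_cancel]
  simpa [hm m le_rfl] using hind m

/-- Lets `ε` tend to `0`, which is harmless because `HasStretchAt` only concerns constants above the
given one. -/
lemma hasStretchAt_flow [T2Space M] {X : Π x : M, TangentSpace 𝓘(ℝ, E) x}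
    (hX : ContMDiff 𝓘(ℝ, E) 𝓘(ℝ, E).tangent ∞ (fun x ↦ (⟨x, X x⟩ : TangentBundle 𝓘(ℝ, E) M)))
    {C : ℝ} (hC : ∀ x, ‖leviCivita E M X x‖ ≤ C) {φ : ℝ → M → M} (hφ0 : ∀ x, φ 0 x = x)
    (hφ : ∀ x, IsMIntegralCurve (φ · x) X) (hadd : ∀ s t x, φ (s + t) x = φ s (φ t x))
    (x : M) {T : ℝ} (hT : 0 ≤ T) : HasStretchAt E (φ T) x (Real.exp (C * T)) := by
  refine .of_forall_gt fun L hL ↦ ?_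
  have hcont : ContinuousAt (fun ε : ℝ ↦ Real.exp ((C + ε) * T)) 0 := by fun_prop
  have h1 : ∀ᶠ ε in 𝓝[>] (0 : ℝ), Real.exp ((C + ε) * T) < L :=
    nhdsWithin_le_nhds (hcont.eventually_lt_const (by simpa using hL))
  obtain ⟨ε, h2, hε⟩ := (h1.and self_mem_nhdsWithin).exists
  exact ⟨_, h2, hasStretchAt_flow_add hX hC hφ0 hφ hadd x hε hT⟩

/-- A map that infinitesimally stretches distances by at most a factor `K` is `K`-Lipschitz. -/
lemma riemannianEDist_le_of_hasStretchAt [ConnectedSpace M] {f : M → M} {K : ℝ} (hK : 0 < K)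
    (hf : ∀ y, HasStretchAt E f y K) (x y : M) :
    riemannianEDist 𝓘(ℝ, E) (f x) (f y) ≤ riemannianEDist 𝓘(ℝ, E) x y * ENNReal.ofReal K := by
  have hlen : ∀ r > riemannianEDist 𝓘(ℝ, E) x y,
      riemannianEDist 𝓘(ℝ, E) (f x) (f y) ≤ r * ENNReal.ofReal K := by
    intro r hr
    obtain ⟨γ, rfl, rfl, hγ, hγr, -⟩ := exists_lt_locally_constant_of_riemannianEDist_lt hr
      zero_lt_one
    have hsp := continuous_speed hγ
    set v : ℝ → ℝ := fun u ↦ ‖mfderiv 𝓘(ℝ, ℝ) 𝓘(ℝ, E) γ u 1‖ with hv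
    let d : ℝ → ℝ := fun u ↦ (riemannianEDist 𝓘(ℝ, E) (f (γ 0)) (f (γ u))).toReal
    have hne : ∀ a b : M, riemannianEDist 𝓘(ℝ, E) a b ≠ ⊤ := riemannianEDist_ne_top
    have hdsub : ∀ u u', d u' - d u ≤ (riemannianEDist 𝓘(ℝ, E) (f (γ u)) (f (γ u'))).toReal := by
      intro u u'
      rw [sub_le_iff_le_add', ← ENNReal.toReal_add (hne _ _) (hne _ _)]
      exact ENNReal.toReal_mono (ENNReal.add_ne_top.2 ⟨hne _ _, hne _ _⟩) riemannianEDist_triangle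
    have hloc : ∀ u, ∀ K' > K, ∀ᶠ u' in 𝓝 u, (riemannianEDist 𝓘(ℝ, E) (f (γ u)) (f (γ u'))).toReal
        ≤ K' * chartGauge E (γ u) (γ u') := by
      intro u K' hK'
      filter_upwards [hγ.continuous.continuousAt.eventually
        ((hf (γ u)).eventually_riemannianEDist_le hK hK')] with u' hu'
      exact ENNReal.toReal_le_of_le_ofReal
        (mul_nonneg (hK.trans hK').le (chartGauge_nonneg _ _)) hu'
    have hdc : Continuous d := by
      refine continuous_iff_continuousAt.2 fun u ↦ ?_
      rw [ContinuousAt, tendsto_iff_norm_sub_tendsto_zero]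
      have h0 : Tendsto (fun u' ↦ (K + 1) * chartGauge E (γ u) (γ u')) (𝓝 u) (𝓝 0) := by
        simpa using ((tendsto_chartGauge (γ u)).comp hγ.continuous.continuousAt).const_mul (K + 1)
      refine squeeze_zero' (Eventually.of_forall fun _ ↦ norm_nonneg _) ?_ h0
      filter_upwards [hloc u (K + 1) (lt_add_one K)] with u' hu'
      refine le_trans (abs_sub_le_iff.2 ⟨hdsub u u', ?_⟩) hu'
      rw [riemannianEDist_comm]
      exact hdsub u' u
    have hder : ∀ u, HasDerivAt (fun u ↦ K * ∫ s in (0 : ℝ)..u, v s) (K * v u) u := fun u ↦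
      (hsp.integral_hasStrictDerivAt 0 u).hasDerivAt.const_mul K
    -- `d` need not be differentiable: its right slopes at `u` are eventually below any `r > K * v
    -- u`, which suffices for comparison with `K` times the arc length.
    have hmain := image_le_of_liminf_slope_right_le_deriv_boundary (f := d) (a := 0) (b := 1)
      hdc.continuousOn (B := fun u ↦ K * ∫ s in (0 : ℝ)..u, v s) (B' := fun u ↦ K * v u)
      (by simp [d, riemannianEDist_self])
      (fun u _ ↦ (hder u).continuousAt.continuousWithinAt)
      (fun u _ ↦ (hder u).hasDerivWithinAt) (by
        intro u _ r hr
        have h1 : ∀ᶠ K' in 𝓝[>] K, K' * v u < r :=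
          nhdsWithin_le_nhds ((continuousAt_id.mul continuousAt_const).eventually_lt_const hr)
        obtain ⟨K', h2, hK'⟩ := (h1.and self_mem_nhdsWithin).exists
        have h3 := (tendsto_chartGauge_div
          ((hγ.mdifferentiable one_ne_zero) u)).const_mul K'
        refine Eventually.frequently ?_
        filter_upwards [h3.eventually_lt_const h2, nhdsWithin_le_nhds (hloc u K' hK'),
          self_mem_nhdsWithin] with u' h4 h5 h6
        refine lt_of_le_of_lt ?_ h4
        have hp : 0 < u' - u := sub_pos.2 h6
        rw [slope_def_field, div_eq_inv_mul, mul_left_comm]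
        gcongr
        exact (hdsub u u').trans h5) (right_mem_Icc.2 zero_le_one)
    rw [← ENNReal.ofReal_toReal (hne (f (γ 0)) (f (γ 1)))]
    refine (ENNReal.ofReal_le_ofReal hmain).trans ?_
    rw [ENNReal.ofReal_mul hK.le, mul_comm, ← pathELength_eq_ofReal_integral hγ zero_le_one]
    gcongr
  -- `hlen` only covers `r` above the distance; dividing by the nonzero finite factor isolates the
  -- distance so that `r` can decrease to it.
  rw [← ENNReal.div_le_iff_le_mul (by simp [hK]) (by simp)]
  refine le_of_forall_gt_imp_ge_of_dense fun r hr ↦ ?_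
  rw [ENNReal.div_le_iff_le_mul (by simp [hK]) (by simp)]
  exact hlen r hr

end FlowStretch

theorem theorem2 {E : Type*} [NormedAddCommGroup E] [NormedSpace ℝ E] [FiniteDimensional ℝ E]
    {M : Type*} [TopologicalSpace M] [T2Space M] [ConnectedSpace M]
    [ChartedSpace E M] [IsManifold 𝓘(ℝ, E) ∞ M]
    [RiemannianBundle (fun x : M ↦ TangentSpace 𝓘(ℝ, E) x)]
    [IsContMDiffRiemannianBundle 𝓘(ℝ, E) ∞ E (fun x : M ↦ TangentSpace 𝓘(ℝ, E) x)]
    (X : Π x : M, TangentSpace 𝓘(ℝ, E) x)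
    (hX : ContMDiff 𝓘(ℝ, E) 𝓘(ℝ, E).tangent ∞ (fun x ↦ (⟨x, X x⟩ : TangentBundle 𝓘(ℝ, E) M)))
    (hXc : IsCompleteVectorField X)
    (C : ℝ) (hC : IsLUB (Set.range fun x : M ↦ ‖leviCivita E M X x‖) C)
    (p₀ q₀ : M) (p q : ℝ → M)
    (hp₀ : p 0 = p₀) (hp : IsMIntegralCurve p X)
    (hq₀ : q 0 = q₀) (hq : IsMIntegralCurve q X) :
    Manifold.riemannianEDist 𝓘(ℝ, E) p₀ q₀ ≠ ⊤ ∧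
      ∀ t : ℝ, 0 ≤ t →
        Manifold.riemannianEDist 𝓘(ℝ, E) (p t) (q t)
          ≤ Manifold.riemannianEDist 𝓘(ℝ, E) p₀ q₀ * ENNReal.ofReal (Real.exp (C * t)) := by
  refine ⟨riemannianEDist_ne_top p₀ q₀, fun t ht ↦ ?_⟩
  choose φ hφ0 hφ using hXc
  have : IsManifold 𝓘(ℝ, E) 1 M := .of_le (n := ∞) (by simp)
  have hX1 := hX.of_le (m := 1) (by simp)
  -- Uniqueness of integral curves turns the chosen curves into a flow with the group law and
  -- identifies `p` and `q` with its orbits.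
  have huniq : ∀ γ γ' : ℝ → M, IsMIntegralCurve γ X → IsMIntegralCurve γ' X → γ 0 = γ' 0 →
      γ = γ' := fun γ γ' h h' h0 ↦
    isMIntegralCurve_Ioo_eq_of_contMDiff_boundaryless (t₀ := 0) hX1 h h' h0
  have hadd : ∀ s t x, φ x (s + t) = φ (φ x t) s := by
    intro s t x
    refine congrFun (huniq (φ x ∘ (· + t)) (φ (φ x t)) ((hφ x).comp_add t) (hφ _) ?_) s
    simp [hφ0]
  have h := riemannianEDist_le_of_hasStretchAt (Real.exp_pos (C * t))
    (fun y ↦ hasStretchAt_flow (φ := fun s x ↦ φ x s) hX (fun x ↦ hC.1 ⟨x, rfl⟩) hφ0 hφ hadd y ht)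
    p₀ q₀
  rwa [huniq p (φ p₀) hp (hφ p₀) (hp₀.trans (hφ0 p₀).symm),
    huniq q (φ q₀) hq (hφ q₀) (hq₀.trans (hφ0 q₀).symm)]
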